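/- Let $R$ be a finite reduced (not necessarily crystallographic) root system in a finite-dimensional real vector space $V_0$ (which $R$ need not span), with coroots $\alpha^\vee\in V_0^*$ and reflections $s_\alpha(v)=v-\langle v,\alpha^\vee\rangle\alpha$, let $W$ be the finite reflection group generated by the $s_\alpha$, let $\Pi\subset R$ be a set of simple roots, and let $V=\mathbb{C}\otimes_{\mathbb{R}}V_0$. Let $k:\Pi\to\mathbb{C}$, $\alpha\mapsto k_\alpha$, be a function with $k_\alpha=k_{\alpha'}$ whenever $\alpha,\alpha'\in\Pi$ lie in the same $W$-orbit. Let $\mathbb{H}$ be the graded affine Hecke algebra, i.e. the unital associative $\mathbb{C}$-algebra generated by symbols $t_w$ ($w\in W$) and $v\in V$, subject to the relations of $\mathbb{C}[W]$ among the $t_w$, the relations of the symmetric algebra $S(V)$ among the $v\in V$, and $$t_{s_\alpha}v-s_\alpha(v)t_{s_\alpha}=k_\alpha\langle v,\alpha^\vee\rangle\qquad(\alpha\in\Pi,\ v\in V).$$ Let $X$ and $Y$ be $\mathbb{H}$-modules that are finite-dimensional over $\mathbb{C}$. Then every $\mathrm{Ext}^i_{\mathbb{H}}(X,Y)$ is finite-dimensional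 over $\mathbb{C}$, only finitely many of them are nonzero, and $$\sum_{i\ge 0}(-1)^i\dim_{\mathbb{C}}\mathrm{Ext}^i_{\mathbb{H}}(X,Y)=\frac1{|W|}\sum_{w\in W}\mathrm{tr}_X(t_w)\,\overline{\mathrm{tr}_Y(t_w)}\,\det\nolimits_V(1-w).$$ In particular, the left-hand side (the Euler–Poincaré pairing) depends only on the $W$-module structures of $X$ and $Y$: if $X,X',Y,Y'$ are finite-dimensional $\mathbb{H}$-modules with $X\cong X'$ and $Y\cong Y'$ as $W$-representations, then the pairing of $X$ and $Y$ equals that of $X'$ and $Y'$. -/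

import Mathlib

open scoped TensorProduct ComplexConjugate

universe u

noncomputable section

namespace GradedHecke

section WeylGroup

variable {ι V₀ N : Type u} [AddCommGroup V₀] [Module ℝ V₀] [AddCommGroup N] [Module ℝ N]

/-- The Weyl group acts trivially on the vectors killed by all coroots. -/
lemma weylGroup_smul_eq_self (P : RootPairing ι ℝ V₀ N) (w : P.weylGroup) (x : V₀)
    (hx : ∀ i, P.coroot' i x = 0) : w • x = x := by
  obtain ⟨g, hg⟩ := w
  induction hg using RootPairing.weylGroup.induction with
  | mem i =>
    have h : (RootPairing.Equiv.reflection P i) • x = P.reflection i x := rfl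
    change (RootPairing.Equiv.reflection P i) • x = x
    rw [h, RootPairing.reflection_apply, hx i, zero_smul, sub_zero]
  | one => exact one_smul _ x
  | mul g₁ g₂ h₁ h₂ ih₁ ih₂ =>
    change (g₁ * g₂) • x = x
    change g₁ • x = x at ih₁
    change g₂ • x = x at ih₂
    rw [mul_smul, ih₂, ih₁]

/-- The Weyl group of a finite real root system is finite, even if the roots do not span. -/
instance finite_weylGroup [Finite ι] (P : RootPairing ι ℝ V₀ N) : Finite P.weylGroup := by
  have := Fintype.ofFinite ι
  have hinj : Function.Injective P.weylGroupToPerm := by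
    intro g h hgh
    apply Subtype.ext
    apply RootPairing.Equiv.weightHom_injective
    ext x
    change g • x = h • x
    have hx : x ∈ P.rootSpan ℝ ⊔ LinearMap.ker P.RootForm := by
      rw [P.isCompl_rootSpan_ker_rootForm.sup_eq_top]
      exact Submodule.mem_top
    obtain ⟨y, hy, z, hz, rfl⟩ := Submodule.mem_sup.mp hx
    have hz' : ∀ i, P.coroot' i z = 0 := by
      have h0 : P.RootForm z z = 0 := by rw [LinearMap.mem_ker.mp hz]; rfl
      rw [RootPairing.rootForm_apply_apply,
        Finset.sum_eq_zero_iff_of_nonneg (fun i _ => mul_self_nonneg _)] at h0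
      exact fun i => mul_self_eq_zero.mp (h0 i (Finset.mem_univ i))
    rw [smul_add, smul_add, weylGroup_smul_eq_self P g z hz', weylGroup_smul_eq_self P h z hz']
    congr 1
    clear hx
    induction hy using Submodule.span_induction with
    | mem y hy =>
      obtain ⟨i, rfl⟩ := hy
      rw [P.weylGroup_apply_root, P.weylGroup_apply_root, hgh]
    | zero => rw [smul_zero, smul_zero]
    | add a b _ _ ha hb => rw [smul_add, smul_add, ha, hb]
    | smul c a _ ha => rw [smul_comm, smul_comm h, ha]
  exact Finite.of_injective _ hinj

instance fintype_weylGroup [Finite ι] (P : RootPairing ι ℝ V₀ N) : Fintype P.weylGroup :=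
  Fintype.ofFinite _

/-- A simple system `Π` in a (not necessarily crystallographic) real root system: a linearly
independent set of roots such that every root is a linear combination of elements of `Π` with
real coefficients that are all nonnegative or all nonpositive. -/
structure SimpleSystem (P : RootPairing ι ℝ V₀ N) where
  /-- The indices of the simple roots. -/
  support : Finset ι
  linearIndepOn_root : LinearIndepOn ℝ P.root (support : Set ι)
  exists_nonneg_or_nonpos : ∀ i : ι, ∃ c : ι → ℝ,
    ((∀ j ∈ support, 0 ≤ c j) ∨ (∀ j ∈ support, c j ≤ 0)) ∧
      P.root i = ∑ j ∈ support, c j • P.root j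

/-- The parameter `k : Π → ℂ` takes the same value on simple roots in the same `W`-orbit. -/
def IsParameterFunction {P : RootPairing ι ℝ V₀ N} (S : SimpleSystem P)
    (k : S.support → ℂ) : Prop :=
  ∀ i j : S.support, (∃ w : P.weylGroup, w • P.root (i : ι) = P.root (j : ι)) → k i = k j

/-- The action of `w ∈ W` on the complexification `V = ℂ ⊗ V₀`. -/
def weylAction (P : RootPairing ι ℝ V₀ N) (w : P.weylGroup) :
    (ℂ ⊗[ℝ] V₀) →ₗ[ℂ] (ℂ ⊗[ℝ] V₀) :=
  (P.weylGroupRootRep w).baseChange ℂ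

/-- The complex-linear extension `v ↦ ⟨v, α_i^∨⟩` of the `i`-th coroot to `V = ℂ ⊗ V₀`. -/
def corootC (P : RootPairing ι ℝ V₀ N) (i : ι) : (ℂ ⊗[ℝ] V₀) →ₗ[ℂ] ℂ :=
  Module.Dual.baseChange ℂ (P.coroot' i)

end WeylGroup

section Algebra

variable {ι V₀ N : Type u} [AddCommGroup V₀] [Module ℝ V₀] [AddCommGroup N] [Module ℝ N]
  {P : RootPairing ι ℝ V₀ N} (S : SimpleSystem P) (k : S.support → ℂ)

/-- The free associative algebra on the symbols `t_w` (`w ∈ W`) and `f_v` (`v ∈ V`). -/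
abbrev FreeGen (P : RootPairing ι ℝ V₀ N) : Type u :=
  FreeAlgebra ℂ (P.weylGroup ⊕ (ℂ ⊗[ℝ] V₀))

/-- The symbol `t_w`. -/
def FreeGen.t (w : P.weylGroup) : FreeGen P := FreeAlgebra.ι ℂ (Sum.inl w)

/-- The symbol `f_v`. -/
def FreeGen.f (v : ℂ ⊗[ℝ] V₀) : FreeGen P := FreeAlgebra.ι ℂ (Sum.inr v)

/-- The defining relations of the graded affine Hecke algebra: `w ↦ t_w` extends to an algebra
map on `ℂ[W]`, `v ↦ f_v` extends to an algebra map on `S(V)`, and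
`t_{s_α} v - s_α(v) t_{s_α} = k_α ⟨v, α^∨⟩` for `α ∈ Π` and `v ∈ V`. -/
inductive Rel : FreeGen P → FreeGen P → Prop
  | t_one : Rel (FreeGen.t 1) 1
  | t_mul (w w' : P.weylGroup) : Rel (FreeGen.t (w * w')) (FreeGen.t w * FreeGen.t w')
  | f_add (v v' : ℂ ⊗[ℝ] V₀) : Rel (FreeGen.f (v + v')) (FreeGen.f v + FreeGen.f v')
  | f_smul (c : ℂ) (v : ℂ ⊗[ℝ] V₀) : Rel (FreeGen.f (c • v)) (c • FreeGen.f v)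
  | f_comm (v v' : ℂ ⊗[ℝ] V₀) : Rel (FreeGen.f v * FreeGen.f v') (FreeGen.f v' * FreeGen.f v)
  | cross (i : S.support) (v : ℂ ⊗[ℝ] V₀) :
      Rel (FreeGen.t (RootPairing.weylGroup.ofIdx P i) * FreeGen.f v -
            FreeGen.f (weylAction P (RootPairing.weylGroup.ofIdx P i) v) *
              FreeGen.t (RootPairing.weylGroup.ofIdx P i))
          (algebraMap ℂ (FreeGen P) (k i * corootC P i v))

/-- The graded affine Hecke algebra `ℍ(Π, k)`. -/
def HeckeAlgebra : Type u := RingQuot (Rel S k)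

instance : Ring (HeckeAlgebra S k) := inferInstanceAs (Ring (RingQuot (Rel S k)))

instance : Algebra ℂ (HeckeAlgebra S k) := inferInstanceAs (Algebra ℂ (RingQuot (Rel S k)))

/-- The quotient map from the free algebra to the graded affine Hecke algebra. -/
def HeckeAlgebra.mk : FreeGen P →ₐ[ℂ] HeckeAlgebra S k := RingQuot.mkAlgHom ℂ (Rel S k)

/-- The group homomorphism `w ↦ t_w` from `W` to `ℍ`. -/
def HeckeAlgebra.t : P.weylGroup →* HeckeAlgebra S k where
  toFun w := HeckeAlgebra.mk S k (FreeGen.t w)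
  map_one' := (RingQuot.mkAlgHom_rel ℂ (Rel.t_one (S := S) (k := k))).trans (map_one _)
  map_mul' w w' :=
    (RingQuot.mkAlgHom_rel ℂ (Rel.t_mul (S := S) (k := k) w w')).trans (map_mul _ _ _)

end Algebra

section Pairings

variable {ι V₀ N : Type u} [AddCommGroup V₀] [Module ℝ V₀] [AddCommGroup N] [Module ℝ N]
  {P : RootPairing ι ℝ V₀ N} (S : SimpleSystem P) (k : S.support → ℂ)

/-- The restriction `Res_W X` of an `ℍ`-module `X` to `W`, as a complex representation. -/
def resW (X : Type u) [AddCommGroup X] [Module ℂ X] [Module (HeckeAlgebra S k) X]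
    [IsScalarTower ℂ (HeckeAlgebra S k) X] : Representation ℂ P.weylGroup X :=
  ((Algebra.lsmul ℂ ℂ X : HeckeAlgebra S k →ₐ[ℂ] Module.End ℂ X) :
    HeckeAlgebra S k →* Module.End ℂ X).comp (HeckeAlgebra.t S k)

/-- The vector space `Ext^i_ℍ(X, Y)` in the category of (left) `ℍ`-modules. -/
abbrev ExtH (X Y : Type u) [AddCommGroup X] [AddCommGroup Y] [Module (HeckeAlgebra S k) X]
    [Module (HeckeAlgebra S k) Y] (i : ℕ) : Type u :=
  CategoryTheory.Abelian.Ext (ModuleCat.of (HeckeAlgebra S k) X)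
    (ModuleCat.of (HeckeAlgebra S k) Y) i

/-- The Euler–Poincaré pairing `∑_i (-1)^i dim Ext^i_ℍ(X, Y)`. -/
def eulerPoincare (X Y : Type u) [AddCommGroup X] [AddCommGroup Y]
    [Module (HeckeAlgebra S k) X] [Module (HeckeAlgebra S k) Y] : ℤ :=
  ∑ᶠ i : ℕ, (-1 : ℤ) ^ i * (Module.finrank ℂ (ExtH S k X Y i) : ℤ)

/-- The elliptic pairing `|W|⁻¹ ∑_w tr_U(w) conj(tr_U'(w)) det_V(1 - w)` of finite-dimensional
representations of `W`. -/
def ellipticPairing [Finite ι] {U U' : Type u} [AddCommGroup U] [Module ℂ U]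
    [AddCommGroup U'] [Module ℂ U'] (ρ : Representation ℂ P.weylGroup U)
    (σ : Representation ℂ P.weylGroup U') : ℂ :=
  (Fintype.card P.weylGroup : ℂ)⁻¹ *
    ∑ w : P.weylGroup, ρ.character w * conj (σ.character w) *
      LinearMap.det (1 - weylAction P w)

end Pairings

end GradedHecke

end

/-! The module `Y` has a finite injective coresolution of Koszul type. Its `n`-th term
(`koszulTerm`) is coinduced from `ℂ[W]` to `ℍ`: it consists of the `W`-equivariant alternating
`n`-forms on `V` with values in `Hom_ℂ(ℍ, Y)`. Since `ℂ[W]` is semisimple, these terms are injective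
(`injective_koszulTerm`). By Frobenius reciprocity (`homEquiv`), `Hom_ℍ(X, -)` of the `n`-th term is
`Hom_W(X, Λⁿ V* ⊗ Y)`, which is finite-dimensional and vanishes for `n > dim V`. So the Euler
characteristic of `Ext` is the alternating sum of the dimensions of these spaces
(`HasEulerChar.of_coresolution`), where neither `k` nor the action of `V` on `X` and `Y` enters.
Character orthogonality and `∑ (-1)ⁿ tr Λⁿ g = det (1 - g)` (`sum_character_altRep`) turn it into
the elliptic pairing.

The differential is the Koszul differential of the commuting operators `(A_v φ)(h) = v φ(h) - φ(v
h)`. Two points need an argument.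

It must preserve `W`-equivariance, although a single `A_v` is not equivariant. The relation between
`t_s` and `v` produces the error `k_α α^∨ ∧ (s^* ω - ω)`, and this vanishes because `s^* ω - ω` is
itself a multiple of `α^∨` (`wedge_compLinearMap_reflection`, `d_mem_koszulTerm`).

The complex must be exact. By the PBW theorem `ℍ = ℂ[W] ⊗ S(V)`, so restriction to `S(V)` identifies
the equivariant forms with all forms valued in `Hom_ℂ(S(V), Y)` (`polyRes_injective`,
`polyRes_surjective`). There the operators form a coregular sequence (`exists_coregular`), which
gives exactness (`exists_d_eq`). PBW itself is proved by letting `ℍ` act on functions `W → S(V)`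
through explicit operators (`PBW.rep`). -/

noncomputable section

namespace GradedHecke

/-! ### Positive roots, and generation of `W` by simple reflections. -/

section Roots

open RootPairing

variable {ι V₀ N : Type u} [AddCommGroup V₀] [Module ℝ V₀] [AddCommGroup N] [Module ℝ N]
  {P : RootPairing ι ℝ V₀ N}

lemma ofIdx_smul_vec (i : ι) (x : V₀) :
    weylGroup.ofIdx P i • x = x - P.coroot' i x • P.root i :=
  P.reflection_apply i x

lemma root_smul (w : P.weylGroup) (i : ι) : P.root (w • i) = w • P.root i :=
  (P.weylGroup_apply_root w i).symm

lemma weylGroup_ext {w w' : P.weylGroup} (h : ∀ x : V₀, w • x = w' • x) : w = w' := by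
  apply Subtype.ext
  apply RootPairing.Equiv.weightHom_injective
  ext x
  exact h x

@[simp] lemma ofIdx_mul_self (i : ι) : weylGroup.ofIdx P i * weylGroup.ofIdx P i = 1 := by
  refine weylGroup_ext fun x => ?_
  rw [mul_smul, one_smul]
  exact P.reflection_same i x

@[simp] lemma ofIdx_inv (i : ι) : (weylGroup.ofIdx P i)⁻¹ = weylGroup.ofIdx P i :=
  inv_eq_of_mul_eq_one_right (ofIdx_mul_self i)

lemma ofIdx_smul_smul_idx (i j : ι) :
    weylGroup.ofIdx P i • weylGroup.ofIdx P i • j = j := by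
  rw [smul_smul, ofIdx_mul_self, one_smul]

lemma ofIdx_reflection (i j : ι) :
    weylGroup.ofIdx P (weylGroup.ofIdx P i • j) =
      weylGroup.ofIdx P i * weylGroup.ofIdx P j * weylGroup.ofIdx P i := by
  refine weylGroup_ext fun x => ?_
  rw [mul_smul, mul_smul]
  exact LinearEquiv.congr_fun (P.reflection_reflectionPerm (i := j) (j := i)) x

/-- The index of the negative of a root. -/
def negIdx (P : RootPairing ι ℝ V₀ N) (i : ι) : ι := weylGroup.ofIdx P i • i

lemma root_negIdx (i : ι) : P.root (negIdx P i) = -P.root i := by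
  rw [negIdx, root_smul, ofIdx_smul_vec]
  have : P.coroot' i (P.root i) = 2 := P.root_coroot_two i
  rw [this, two_smul]; abel

lemma root_ne_zero (i : ι) : P.root i ≠ 0 := P.ne_zero i

lemma negIdx_negIdx (i : ι) : negIdx P (negIdx P i) = i := by
  apply P.root.injective
  rw [root_negIdx, root_negIdx, neg_neg]

lemma smul_negIdx (w : P.weylGroup) (i : ι) : w • negIdx P i = negIdx P (w • i) := by
  apply P.root.injective
  rw [root_smul, root_negIdx, root_negIdx, root_smul, smul_neg]

lemma ofIdx_negIdx (i : ι) : weylGroup.ofIdx P (negIdx P i) = weylGroup.ofIdx P i := by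
  rw [negIdx, ofIdx_reflection, ofIdx_mul_self, one_mul]

lemma negIdx_ne (i : ι) : negIdx P i ≠ i := fun h => by
  have := root_negIdx (P := P) i
  rw [h] at this
  have := two_smul ℝ (P.root i) ▸ eq_neg_iff_add_eq_zero.mp this
  exact root_ne_zero i ((smul_eq_zero.mp this).resolve_left two_ne_zero)

lemma coroot'_smul (i j : ι) (x : V₀) :
    P.coroot' (weylGroup.ofIdx P i • j) x = P.coroot' j (weylGroup.ofIdx P i • x) :=
  LinearMap.congr_fun (P.coroot'_reflectionPerm (i := i) (j := j)) x

lemma coroot'_negIdx (i : ι) (x : V₀) : P.coroot' (negIdx P i) x = - P.coroot' i x := by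
  rw [negIdx, coroot'_smul, ofIdx_smul_vec, map_sub, map_smul]
  have : P.coroot' i (P.root i) = 2 := P.root_coroot_two i
  rw [this, smul_eq_mul]; ring

namespace SimpleSystem

variable (S : SimpleSystem P)

/-- A root is positive if it is a nonnegative combination of simple roots. -/
def IsPos (i : ι) : Prop :=
  ∃ c : ι → ℝ, (∀ j ∈ S.support, 0 ≤ c j) ∧ P.root i = ∑ j ∈ S.support, c j • P.root j

variable {S}

lemma coeff_unique {c d : ι → ℝ}
    (h : ∑ j ∈ S.support, c j • P.root j = ∑ j ∈ S.support, d j • P.root j) :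
    ∀ j ∈ S.support, c j = d j := by
  intro j hj
  have := linearIndepOn_finset_iff.mp S.linearIndepOn_root (fun j => c j - d j) (by
    simp only [sub_smul, Finset.sum_sub_distrib, h, sub_self]) j hj
  linarith

lemma isPos_or_isPos_negIdx (i : ι) : S.IsPos i ∨ S.IsPos (negIdx P i) := by
  obtain ⟨c, hc | hc, h⟩ := S.exists_nonneg_or_nonpos i
  · exact Or.inl ⟨c, hc, h⟩
  · refine Or.inr ⟨fun j => - c j, fun j hj => neg_nonneg.mpr (hc j hj), ?_⟩
    simp [root_negIdx, h]

lemma isPos_negIdx_iff (i : ι) : S.IsPos (negIdx P i) ↔ ¬ S.IsPos i := by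
  refine ⟨?_, fun h => (isPos_or_isPos_negIdx i).resolve_left h⟩
  rintro ⟨c, hc, h⟩ ⟨d, hd, h'⟩
  rw [root_negIdx, h'] at h
  have := coeff_unique (S := S) (c := fun j => - d j) (d := c) (by
    rw [← h]; simp)
  apply root_ne_zero (P := P) i
  rw [h']
  refine Finset.sum_eq_zero fun j hj => ?_
  have h1 := this j hj
  have h2 := hc j hj
  have h3 := hd j hj
  have : d j = 0 := by linarith
  rw [this, zero_smul]

lemma isPos_of_mem {i : ι} (hi : i ∈ S.support) : S.IsPos i := by
  classical
  refine ⟨fun j => if j = i then 1 else 0, fun j _ => by dsimp only; split_ifs <;> norm_num, ?_⟩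
  simp [hi]

/-- The reflection `s_i` alters only the coefficient of the simple root `i`. If the image were
negative, all other coefficients would vanish, so the root would be proportional to the simple root
`i`; reducedness leaves only that root and its negative, and the negative is not positive. -/
lemma isPos_simple_smul_of_isPos [P.IsReduced] {i j : ι} (hi : i ∈ S.support) (hj : S.IsPos j)
    (hji : j ≠ i) : S.IsPos (weylGroup.ofIdx P i • j) := by
  classical
  by_contra hneg
  rw [← isPos_negIdx_iff] at hneg
  obtain ⟨d, hd, h⟩ := hneg
  obtain ⟨c, hc, h'⟩ := hj
  rw [root_negIdx, root_smul, ofIdx_smul_vec, neg_sub, sub_eq_iff_eq_add, h'] at h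
  have key := coeff_unique (S := S)
    (c := fun l => if l = i then P.coroot' i (P.root j) else 0) (d := fun l => d l + c l) (by
      simp only [add_smul, Finset.sum_add_distrib, ite_smul, zero_smul]
      rw [Finset.sum_ite_eq' S.support i, if_pos hi, ← h, h'])
  have hroot : P.root j = c i • P.root i := by
    rw [h']
    refine Finset.sum_eq_single_of_mem i hi fun l hl hli => ?_
    have h1 := key l hl
    rw [if_neg hli] at h1
    have : c l = 0 := by linarith [hd l hl, hc l hl]
    rw [this, zero_smul]
  have hdep : ¬ LinearIndependent ℝ ![P.root j, P.root i] := by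
    rw [LinearIndependent.pair_iff]
    intro hh
    have := (hh 1 (-c i) (by rw [hroot]; simp)).1
    norm_num at this
  rcases IsReduced.eq_or_eq_neg (P := P) j i hdep with h1 | h1
  · exact hji (P.root.injective h1)
  · have h3 : c i = -1 := by
      have : (c i + 1) • P.root i = 0 := by rw [add_smul, ← hroot, h1]; simp
      have := (smul_eq_zero.mp this).resolve_right (root_ne_zero i)
      linarith
    linarith [hc i hi]

lemma isPos_simple_smul_iff [P.IsReduced] {i j : ι} (hi : i ∈ S.support)
    (hji : j ≠ i) (hji' : j ≠ negIdx P i) :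
    S.IsPos (weylGroup.ofIdx P i • j) ↔ S.IsPos j := by
  refine ⟨fun h => ?_, fun h => isPos_simple_smul_of_isPos hi h hji⟩
  have := isPos_simple_smul_of_isPos hi h (fun h' => hji' ?_)
  · rwa [ofIdx_smul_smul_idx] at this
  · rw [← ofIdx_smul_smul_idx (P := P) i j, h']; rfl

/-- For the invariant form, `0 < (β, β) = ∑ c_i (β, α_i)` forces some `(β, α_i) > 0`, and this has
the sign of `⟨β, α_i^∨⟩`. -/
lemma exists_simple_pos_coroot [Finite ι] {j : ι} (c : ι → ℝ) (hc : ∀ i ∈ S.support, 0 ≤ c i)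
    (h : P.root j = ∑ i ∈ S.support, c i • P.root i) :
    ∃ i ∈ S.support, 0 < P.coroot' i (P.root j) := by
  have := Fintype.ofFinite ι
  by_contra hcon
  push Not at hcon
  have hpos : 0 < P.RootForm (P.root j) (P.root j) := by
    exact P.rootForm_pos_of_ne_zero (Submodule.subset_span ⟨j, rfl⟩) (root_ne_zero j)
  have hle : P.RootForm (P.root j) (P.root j) ≤ 0 := by
    conv_lhs => rw [h]
    rw [map_sum]
    refine Finset.sum_nonpos fun i hi => ?_
    rw [map_smul, smul_eq_mul, ← h]
    refine mul_nonpos_of_nonneg_of_nonpos (hc i hi) ?_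
    have h1 := P.toInvariantForm.two_mul_apply_root_root j i
    have h2 : 2 * P.RootForm (P.root j) (P.root i) =
      P.coroot' i (P.root j) * P.RootForm (P.root i) (P.root i) := h1
    have h3 : 0 < P.RootForm (P.root i) (P.root i) := 
      P.rootForm_pos_of_ne_zero (Submodule.subset_span ⟨i, rfl⟩) (root_ne_zero i)
    have h4 : 2 * P.RootForm (P.root j) (P.root i) ≤ 0 :=
      h2 ▸ mul_nonpos_of_nonpos_of_nonneg (hcon i hi) h3.le
    linarith
  linarith

/-- Among the positive roots in the orbit under simple reflections, one of minimal height is simple: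
otherwise a simple reflection with positive pairing keeps it positive and lowers its height. -/
lemma exists_simple_conj [P.IsReduced] [Finite ι] (j : ι) (hj : S.IsPos j) :
    ∃ w ∈ Subgroup.closure (weylGroup.ofIdx P '' S.support), w • j ∈ S.support := by
  classical
  have := Fintype.ofFinite ι
  let G := Subgroup.closure (weylGroup.ofIdx P '' (S.support : Set ι))
  let c : ι → ι → ℝ := fun i => (S.exists_nonneg_or_nonpos i).choose
  have hcs : ∀ i, P.root i = ∑ l ∈ S.support, c i l • P.root l :=
    fun i => (S.exists_nonneg_or_nonpos i).choose_spec.2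
  let T : Finset ι := Finset.univ.filter fun i => S.IsPos i ∧ ∃ w ∈ G, w • j = i
  obtain ⟨i, hiT, hmin⟩ := T.exists_min_image (fun i => ∑ l ∈ S.support, c i l)
    ⟨j, Finset.mem_filter.mpr ⟨Finset.mem_univ _, hj, 1, one_mem _, one_smul _ _⟩⟩
  obtain ⟨-, hipos, w, hw, hwi⟩ := Finset.mem_filter.mp hiT
  have hci : ∀ l ∈ S.support, 0 ≤ c i l := by
    obtain ⟨d, hd, h⟩ := hipos
    intro l hl
    rw [coeff_unique ((hcs i).symm.trans h) l hl]
    exact hd l hl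
  obtain ⟨l, hl, hlpos⟩ := exists_simple_pos_coroot (c i) hci (hcs i)
  by_cases hil : i = l
  · exact ⟨w, hw, by rw [hwi, hil]; exact hl⟩
  exfalso
  have hmem : weylGroup.ofIdx P l • i ∈ T := Finset.mem_filter.mpr
    ⟨Finset.mem_univ _, isPos_simple_smul_of_isPos hl hipos hil, weylGroup.ofIdx P l * w,
      mul_mem (Subgroup.subset_closure ⟨l, hl, rfl⟩) hw, by rw [mul_smul, hwi]⟩
  have hle := hmin _ hmem
  have hco : ∀ m ∈ S.support, c (weylGroup.ofIdx P l • i) m =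
      c i m - if m = l then P.coroot' l (P.root i) else 0 := by
    refine coeff_unique ?_
    rw [← hcs, root_smul, ofIdx_smul_vec]
    simp only [sub_smul, Finset.sum_sub_distrib, ← hcs, ite_smul, zero_smul]
    rw [Finset.sum_ite_eq' S.support l, if_pos hl]
  rw [Finset.sum_congr rfl hco, Finset.sum_sub_distrib, Finset.sum_ite_eq' S.support l,
    if_pos hl] at hle
  linarith

lemma ofIdx_smul_eq_conj (w : P.weylGroup) (i : ι) :
    weylGroup.ofIdx P (w • i) = w * weylGroup.ofIdx P i * w⁻¹ := by
  obtain ⟨g, hg⟩ := w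
  induction hg using RootPairing.weylGroup.induction generalizing i with
  | mem j => 
    change weylGroup.ofIdx P (weylGroup.ofIdx P j • i) =
      weylGroup.ofIdx P j * weylGroup.ofIdx P i * (weylGroup.ofIdx P j)⁻¹
    rw [ofIdx_reflection, ofIdx_inv]
  | one =>
    change weylGroup.ofIdx P ((1 : P.weylGroup) • i) = (1 : P.weylGroup) * _ * (1 : P.weylGroup)⁻¹
    simp
  | mul g₁ g₂ h₁ h₂ ih₁ ih₂ =>
    change weylGroup.ofIdx P (((⟨g₁, h₁⟩ : P.weylGroup) * ⟨g₂, h₂⟩) • i) =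
      (((⟨g₁, h₁⟩ : P.weylGroup) * ⟨g₂, h₂⟩)) * _ * (((⟨g₁, h₁⟩ : P.weylGroup) * ⟨g₂, h₂⟩))⁻¹
    rw [mul_smul, ih₁, ih₂]
    group

variable (S) in
-- Every root is, up to sign, conjugate to a simple one by a product of simple reflections, so its
-- reflection is conjugate to a simple reflection inside `G`.
lemma closure_simple_eq_top [P.IsReduced] [Finite ι] :
    Subgroup.closure (weylGroup.ofIdx P '' (S.support : Set ι)) = ⊤ := by
  set G := Subgroup.closure (weylGroup.ofIdx P '' (S.support : Set ι)) with hG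
  have hmem : ∀ j, weylGroup.ofIdx P j ∈ G := by
    have hp : ∀ j, S.IsPos j → weylGroup.ofIdx P j ∈ G := by
      intro j hj
      obtain ⟨w, hw, hwj⟩ := exists_simple_conj j hj
      have h1 : weylGroup.ofIdx P (w • j) ∈ G := Subgroup.subset_closure ⟨_, hwj, rfl⟩
      rw [ofIdx_smul_eq_conj] at h1
      have := mul_mem (mul_mem (inv_mem hw) h1) hw
      simpa [mul_assoc] using this
    intro j
    rcases isPos_or_isPos_negIdx (S := S) j with h | h
    · exact hp j h
    · rw [← ofIdx_negIdx]; exact hp _ h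
  rw [eq_top_iff]
  rintro ⟨g, hg⟩ -
  induction hg using RootPairing.weylGroup.induction with
  | mem i => exact hmem i
  | one => exact one_mem G
  | mul g₁ g₂ h₁ h₂ ih₁ ih₂ => exact mul_mem ih₁ ih₂

variable (S) in
/-- To prove a property of all elements of the Weyl group it suffices to prove it for `1` and to
show that it is stable under left multiplication by simple reflections. -/
lemma weylGroup_induction [P.IsReduced] [Finite ι] {p : P.weylGroup → Prop} (one : p 1)
    (mul : ∀ i ∈ S.support, ∀ w, p w → p (weylGroup.ofIdx P i * w)) (w : P.weylGroup) : p w := by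
  have hw : w ∈ Subgroup.closure (weylGroup.ofIdx P '' (S.support : Set ι)) := by
    rw [closure_simple_eq_top]; trivial
  induction hw using Subgroup.closure_induction_left with
  | one => exact one
  | mul_left x hx y _ ih =>
    obtain ⟨i, hi, rfl⟩ := hx
    exact mul i hi y ih
  | inv_mul_cancel x hx y _ ih =>
    obtain ⟨i, hi, rfl⟩ := hx
    rw [ofIdx_inv]
    exact mul i hi y ih

variable (S) in
open Classical in
/-- The extension of a parameter function from the simple roots to all roots. -/
def extendParam (k : S.support → ℂ) (j : ι) : ℂ :=
  -- The default `0` is harmless: only the `W`-invariance and the values on simple roots are used.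
  if h : ∃ i : S.support, ∃ w : P.weylGroup, w • (i : ι) = j then k h.choose else 0

lemma extendParam_smul {k : S.support → ℂ} (hk : IsParameterFunction S k) (w : P.weylGroup)
    (j : ι) : S.extendParam k (w • j) = S.extendParam k j := by
  unfold extendParam
  by_cases h : ∃ i : S.support, ∃ w : P.weylGroup, w • (i : ι) = j
  · have h' : ∃ i : S.support, ∃ w' : P.weylGroup, w' • (i : ι) = w • j := by
      obtain ⟨i, w', h'⟩ := h
      exact ⟨i, w * w', by rw [mul_smul, h']⟩
    rw [dif_pos h, dif_pos h']
    obtain ⟨w₁, hw₁⟩ := h.choose_spec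
    obtain ⟨w₂, hw₂⟩ := h'.choose_spec
    refine hk _ _ ⟨w₁⁻¹ * w⁻¹ * w₂, ?_⟩
    rw [← root_smul, mul_smul, hw₂, mul_smul, inv_smul_smul, inv_smul_eq_iff.mpr hw₁.symm]
  · have h' : ¬ ∃ i : S.support, ∃ w' : P.weylGroup, w' • (i : ι) = w • j := by
      rintro ⟨i, w', h'⟩
      exact h ⟨i, w⁻¹ * w', by rw [mul_smul, h', inv_smul_smul]⟩
    rw [dif_neg h, dif_neg h']

lemma extendParam_coe {k : S.support → ℂ} (hk : IsParameterFunction S k) (i : S.support) :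
    S.extendParam k i = k i := by
  unfold extendParam
  have h : ∃ i' : S.support, ∃ w : P.weylGroup, w • (i' : ι) = i := ⟨i, 1, one_smul _ _⟩
  rw [dif_pos h]
  obtain ⟨w, hw⟩ := h.choose_spec
  exact hk _ _ ⟨w, by rw [← root_smul, hw]⟩

end SimpleSystem

end Roots

/-! ### The reflection representation on `V = ℂ ⊗ V₀`. -/

section ComplexAction

open RootPairing

variable {ι V₀ N : Type u} [AddCommGroup V₀] [Module ℝ V₀] [AddCommGroup N] [Module ℝ N]
  {P : RootPairing ι ℝ V₀ N}

lemma weylAction_tmul (w : P.weylGroup) (z : ℂ) (x : V₀) :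
    weylAction P w (z ⊗ₜ x) = z ⊗ₜ (w • x) := rfl

lemma weylAction_mul (w w' : P.weylGroup) (v : ℂ ⊗[ℝ] V₀) :
    weylAction P (w * w') v = weylAction P w (weylAction P w' v) := by
  induction v with
  | zero => simp
  | add a b ha hb => simp only [map_add, ha, hb]
  | tmul z x => simp only [weylAction_tmul, mul_smul]

lemma weylAction_one (v : ℂ ⊗[ℝ] V₀) : weylAction P 1 v = v := by
  induction v with
  | zero => simp
  | add a b ha hb => simp only [map_add, ha, hb]
  | tmul z x => simp only [weylAction_tmul, one_smul]

/-- The action of `W` on `V = ℂ ⊗ V₀` as a representation. -/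
def weylRep (P : RootPairing ι ℝ V₀ N) : Representation ℂ P.weylGroup (ℂ ⊗[ℝ] V₀) where
  toFun := weylAction P
  map_one' := LinearMap.ext weylAction_one
  map_mul' w w' := LinearMap.ext (weylAction_mul w w')

lemma corootC_tmul (i : ι) (z : ℂ) (x : V₀) :
    corootC P i (z ⊗ₜ x) = z * (P.coroot' i x : ℂ) := by
  simp [corootC, Module.Dual.baseChange_apply_tmul, mul_comm]

lemma corootC_smul (i j : ι) (v : ℂ ⊗[ℝ] V₀) :
    corootC P (weylGroup.ofIdx P i • j) v =
      corootC P j (weylAction P (weylGroup.ofIdx P i) v) := by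
  induction v with
  | zero => simp
  | add a b ha hb => simp only [map_add, ha, hb]
  | tmul z x => rw [weylAction_tmul, corootC_tmul, corootC_tmul, coroot'_smul]

lemma corootC_negIdx (i : ι) (v : ℂ ⊗[ℝ] V₀) :
    corootC P (negIdx P i) v = -corootC P i v := by
  induction v with
  | zero => simp
  | add a b ha hb => simp only [map_add, ha, hb]; ring
  | tmul z x => rw [corootC_tmul, corootC_tmul, coroot'_negIdx]; simp

lemma weylAction_ofIdx (i : ι) (v : ℂ ⊗[ℝ] V₀) :
    weylAction P (weylGroup.ofIdx P i) v = v - corootC P i v • (1 ⊗ₜ P.root i) := by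
  induction v with
  | zero => simp
  | add a b ha hb => simp only [map_add, ha, hb, add_smul]; abel
  | tmul z x =>
    rw [weylAction_tmul, corootC_tmul, ofIdx_smul_vec, TensorProduct.tmul_sub,
      TensorProduct.smul_tmul', TensorProduct.tmul_smul, TensorProduct.smul_tmul']
    congr 2
    simp [mul_comm]

lemma corootC_weylAction_self (i : ι) (v : ℂ ⊗[ℝ] V₀) :
    corootC P i (weylAction P (weylGroup.ofIdx P i) v) = -corootC P i v := by
  rw [← corootC_smul, ← corootC_negIdx]; rfl

lemma weylAction_ofIdx_ofIdx (i : ι) (v : ℂ ⊗[ℝ] V₀) :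
    weylAction P (weylGroup.ofIdx P i) (weylAction P (weylGroup.ofIdx P i) v) = v := by
  rw [← weylAction_mul, ofIdx_mul_self, weylAction_one]

end ComplexAction

/-! ### Generators, relations and universal property of `ℍ`. -/

namespace HeckeAlgebra

open RootPairing

variable {ι V₀ N : Type u} [AddCommGroup V₀] [Module ℝ V₀] [AddCommGroup N] [Module ℝ N]
  {P : RootPairing ι ℝ V₀ N} (S : SimpleSystem P) (k : S.support → ℂ)

/-- The linear map `v ↦ f_v` from `V` to `ℍ`. -/
def f : (ℂ ⊗[ℝ] V₀) →ₗ[ℂ] HeckeAlgebra S k where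
  toFun v := HeckeAlgebra.mk S k (FreeGen.f v)
  map_add' v v' :=
    (RingQuot.mkAlgHom_rel ℂ (Rel.f_add (S := S) (k := k) v v')).trans (map_add _ _ _)
  map_smul' c v :=
    (RingQuot.mkAlgHom_rel ℂ (Rel.f_smul (S := S) (k := k) c v)).trans (map_smul _ _ _)

lemma f_mul_comm (v v' : ℂ ⊗[ℝ] V₀) : f S k v * f S k v' = f S k v' * f S k v := by
  have := RingQuot.mkAlgHom_rel ℂ (Rel.f_comm (S := S) (k := k) v v')
  rw [map_mul, map_mul] at this
  exact this

lemma t_mul_f (i : S.support) (v : ℂ ⊗[ℝ] V₀) :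
    t S k (weylGroup.ofIdx P i) * f S k v =
      f S k (weylAction P (weylGroup.ofIdx P i) v) * t S k (weylGroup.ofIdx P i) +
        algebraMap ℂ _ (k i * corootC P i v) := by
  have := RingQuot.mkAlgHom_rel ℂ (Rel.cross (S := S) (k := k) i v)
  rw [map_sub, map_mul, map_mul, AlgHom.commutes, sub_eq_iff_eq_add'] at this
  exact this

lemma f_mul_t (i : S.support) (v : ℂ ⊗[ℝ] V₀) :
    f S k v * t S k (weylGroup.ofIdx P i) =
      t S k (weylGroup.ofIdx P i) * f S k (weylAction P (weylGroup.ofIdx P i) v) +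
        algebraMap ℂ _ (k i * corootC P i v) := by
  rw [t_mul_f, weylAction_ofIdx_ofIdx, corootC_weylAction_self, add_assoc, ← map_add]
  simp

lemma induction_gen {p : HeckeAlgebra S k → Prop} (hC : ∀ c, p (algebraMap ℂ _ c))
    (ht : ∀ w, p (t S k w)) (hf : ∀ v, p (f S k v)) (hmul : ∀ a b, p a → p b → p (a * b))
    (hadd : ∀ a b, p a → p b → p (a + b)) (h : HeckeAlgebra S k) : p h := by
  obtain ⟨a, rfl⟩ := RingQuot.mkAlgHom_surjective ℂ (Rel S k) h
  induction a using FreeAlgebra.induction with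
  | grade0 r => exact (AlgHom.commutes (RingQuot.mkAlgHom ℂ (Rel S k)) r).symm ▸ hC r
  | grade1 x =>
    rcases x with w | v
    · exact ht w
    · exact hf v
  | mul a b ha hb => exact (map_mul (RingQuot.mkAlgHom ℂ (Rel S k)) a b).symm ▸ hmul _ _ ha hb
  | add a b ha hb => exact (map_add (RingQuot.mkAlgHom ℂ (Rel S k)) a b).symm ▸ hadd _ _ ha hb

variable {S k}

/-- The universal property of the graded affine Hecke algebra. -/
def lift {A : Type*} [Ring A] [Algebra ℂ A] (T : P.weylGroup →* A) (F : (ℂ ⊗[ℝ] V₀) →ₗ[ℂ] A)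
    (hF : ∀ v v', F v * F v' = F v' * F v)
    (hTF : ∀ (i : S.support) (v : ℂ ⊗[ℝ] V₀), T (weylGroup.ofIdx P i) * F v -
      F (weylAction P (weylGroup.ofIdx P i) v) * T (weylGroup.ofIdx P i) =
        algebraMap ℂ A (k i * corootC P i v)) : HeckeAlgebra S k →ₐ[ℂ] A :=
  RingQuot.liftAlgHom ℂ ⟨FreeAlgebra.lift ℂ (Sum.elim T F), by
    intro a b hab
    cases hab with
    | t_one => simp [FreeGen.t]
    | t_mul w w' => simp [FreeGen.t]
    | f_add v v' => simp [FreeGen.f]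
    | f_smul c v => simp [FreeGen.f]
    | f_comm v v' => simp [FreeGen.f, hF v v']
    | cross i v => 
      rw [map_sub, map_mul, map_mul, AlgHom.commutes]
      simp only [FreeGen.f, FreeGen.t, FreeAlgebra.lift_ι_apply, Sum.elim_inl, Sum.elim_inr]
      exact hTF i v⟩

section lift

variable {A : Type*} [Ring A] [Algebra ℂ A] (T : P.weylGroup →* A) (F : (ℂ ⊗[ℝ] V₀) →ₗ[ℂ] A)
    (hF : ∀ v v', F v * F v' = F v' * F v)
    (hTF : ∀ (i : S.support) (v : ℂ ⊗[ℝ] V₀), T (weylGroup.ofIdx P i) * F v -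
      F (weylAction P (weylGroup.ofIdx P i) v) * T (weylGroup.ofIdx P i) =
        algebraMap ℂ A (k i * corootC P i v))

lemma lift_t (w : P.weylGroup) : lift T F hF hTF (t S k w) = T w :=
  (RingQuot.liftAlgHom_mkAlgHom_apply ℂ _ _ _).trans (FreeAlgebra.lift_ι_apply _ _)

lemma lift_f (v : ℂ ⊗[ℝ] V₀) : lift T F hF hTF (f S k v) = F v :=
  (RingQuot.liftAlgHom_mkAlgHom_apply ℂ _ _ _).trans (FreeAlgebra.lift_ι_apply _ _)

end lift

end HeckeAlgebra

/-! ### The PBW theorem for `ℍ`. -/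

namespace PBW

open RootPairing

variable {ι V₀ N : Type u} [AddCommGroup V₀] [Module ℝ V₀] [AddCommGroup N]
  [Module ℝ N] {P : RootPairing ι ℝ V₀ N} (S : SimpleSystem P) (k : S.support → ℂ)
  {σ : Type*} (b : Module.Basis σ ℂ (ℂ ⊗[ℝ] V₀))

open Classical in
/-- The indicator function of the positive roots. -/
def posInd (i : ι) : ℂ := if S.IsPos i then 1 else 0

lemma posInd_negIdx (i : ι) : posInd S (negIdx P i) = 1 - posInd S i := by
  unfold posInd
  by_cases h : S.IsPos i <;> simp [SimpleSystem.isPos_negIdx_iff, h]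

lemma posInd_mul_posInd_negIdx (i : ι) : posInd S i * posInd S (negIdx P i) = 0 := by
  unfold posInd
  by_cases h : S.IsPos i <;> simp [SimpleSystem.isPos_negIdx_iff, h]

/-- The linear form attached to a vector. -/
def linForm : (ℂ ⊗[ℝ] V₀) →ₗ[ℂ] MvPolynomial σ ℂ := b.constr ℂ MvPolynomial.X

lemma linForm_basis (i : σ) : linForm b (b i) = MvPolynomial.X i := b.constr_basis ℂ _ i

variable (P σ) in
/-- The underlying space of the PBW module `ℂ[W] ⊗ S(V)`. -/
abbrev Carrier := P.weylGroup → MvPolynomial σ ℂ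

variable (P σ) in
/-- The action of `W` on the PBW module. -/
def tOp : P.weylGroup →* Module.End ℂ (Carrier P σ) where
  toFun u := LinearMap.funLeft ℂ _ fun x => u⁻¹ * x
  map_one' := by ext; simp [LinearMap.funLeft]
  map_mul' u w := by
    refine LinearMap.ext fun F => funext fun x => ?_
    simp [LinearMap.funLeft, mul_assoc]

lemma tOp_apply (u x : P.weylGroup) (F : Carrier P σ) : tOp P σ u F x = F (u⁻¹ * x) := rfl

open scoped IsMulCommutative in
/-- The algebra map from polynomials to `ℍ`. -/
def polyHom : MvPolynomial σ ℂ →ₐ[ℂ] HeckeAlgebra S k :=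
  let A := Algebra.adjoin ℂ (Set.range (HeckeAlgebra.f S k))
  have : IsMulCommutative A := Algebra.isMulCommutative_adjoin ℂ (by
    rintro _ ⟨v, rfl⟩ _ ⟨v', rfl⟩
    exact HeckeAlgebra.f_mul_comm S k v v')
  A.val.comp (MvPolynomial.aeval fun i => 
    (⟨HeckeAlgebra.f S k (b i), Algebra.subset_adjoin ⟨b i, rfl⟩⟩ : A))

lemma polyHom_X (i : σ) : polyHom S k b (MvPolynomial.X i) = HeckeAlgebra.f S k (b i) := by
  simp [polyHom]

lemma polyHom_linForm (v : ℂ ⊗[ℝ] V₀) : polyHom S k b (linForm b v) = HeckeAlgebra.f S k v := by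
  have : (polyHom S k b).toLinearMap ∘ₗ linForm b = HeckeAlgebra.f S k :=
    b.ext fun i => by simp [linForm_basis, polyHom_X]
  exact LinearMap.congr_fun this v

variable {S} in
lemma posInd_simple_smul [P.IsReduced] {i : ι} (hi : i ∈ S.support) {j : ι} (h : j ≠ i)
    (h' : j ≠ negIdx P i) : posInd S (weylGroup.ofIdx P i • j) = posInd S j := by
  classical
  exact if_congr (SimpleSystem.isPos_simple_smul_iff hi h h') rfl rfl

/-- The element `w ⊗ p` of the PBW module. -/
def delta (w : P.weylGroup) (p : MvPolynomial σ ℂ) : Carrier P σ :=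
  open Classical in Pi.single w p

lemma tOp_delta (u w : P.weylGroup) (p : MvPolynomial σ ℂ) :
    tOp P σ u (delta w p) = delta (u * w) p := by
  classical
  funext x
  rw [tOp_apply, delta, delta, Pi.single_apply, Pi.single_apply]
  simp only [inv_mul_eq_iff_eq_mul]

variable [Fintype ι]

/-- The action of `V` on the PBW module. -/
def fOp : (ℂ ⊗[ℝ] V₀) →ₗ[ℂ] Module.End ℂ (Carrier P σ) :=
  -- Dictated by the product in `ℍ`: `v t_w p = t_w (w⁻¹ v) p + ∑ k_β ⟨v, β^∨⟩ t_{s_β w} p`, the sum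
  -- over `β > 0` with `w⁻¹ β < 0`. Read at `x = s_β w`, the last condition becomes `x⁻¹ β > 0`.
  LinearMap.mk₂ ℂ (fun v F x => linForm b (weylAction P x⁻¹ v) * F x +
      ∑ β, (posInd S β * posInd S (x⁻¹ • β) * S.extendParam k β * corootC P β v) •
        F (weylGroup.ofIdx P β * x))
    (fun v v' F => funext fun x => by
      simp only [map_add, add_mul, mul_add, add_smul, Finset.sum_add_distrib, Pi.add_apply]; abel)
    (fun c v F => funext fun x => by
      simp only [map_smul, smul_mul_assoc, smul_eq_mul, Pi.smul_apply, smul_add, Finset.smul_sum,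
        smul_smul]
      congr 1
      refine Finset.sum_congr rfl fun β _ => ?_
      congr 1; ring)
    (fun v F G => funext fun x => by
      simp only [Pi.add_apply, mul_add, smul_add, Finset.sum_add_distrib]; abel)
    (fun c v F => funext fun x => by
      simp only [Pi.smul_apply, mul_smul_comm, smul_add, Finset.smul_sum]
      congr 1
      refine Finset.sum_congr rfl fun β _ => ?_
      rw [smul_comm])

lemma fOp_apply (v : ℂ ⊗[ℝ] V₀) (F : Carrier P σ) (x : P.weylGroup) :
    fOp S k b v F x = linForm b (weylAction P x⁻¹ v) * F x +
      ∑ β, (posInd S β * posInd S (x⁻¹ • β) * S.extendParam k β * corootC P β v) •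
        F (weylGroup.ofIdx P β * x) := rfl

variable {S k}

/-- After the substitution `β ↦ s β` the two sums differ only in the factor testing the positivity
of `β`, respectively `s β`. As `s` permutes the positive roots other than `α`, only `β = ±α`
survive, and together they give `k_α ⟨v, α^∨⟩`. -/
lemma tOp_fOp [P.IsReduced] (hk : IsParameterFunction S k) (i : S.support) (v : ℂ ⊗[ℝ] V₀) :
    tOp P σ (weylGroup.ofIdx P i) * fOp S k b v -
      fOp S k b (weylAction P (weylGroup.ofIdx P i) v) * tOp P σ (weylGroup.ofIdx P i) =
        algebraMap ℂ _ (k i * corootC P i v) := by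
  classical
  refine LinearMap.ext fun F => funext fun x => ?_
  set s := weylGroup.ofIdx P (i : ι) with hs
  have hss : s * s = 1 := ofIdx_mul_self _
  have hsi : s⁻¹ = s := ofIdx_inv _
  simp only [LinearMap.sub_apply, Module.End.mul_apply, Pi.sub_apply, Module.algebraMap_end_apply,
    Pi.smul_apply]
  rw [tOp_apply, fOp_apply, fOp_apply, tOp_apply, hsi]
  have h1 : weylAction P (s * x)⁻¹ v = weylAction P x⁻¹ (weylAction P s v) := by
    rw [mul_inv_rev, hsi, weylAction_mul]
  have h2 : ∑ β, (posInd S β * posInd S (x⁻¹ • β) * S.extendParam k β *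
        corootC P β (weylAction P s v)) • (tOp P σ s F) (weylGroup.ofIdx P β * x) =
      ∑ β, (posInd S (s • β) * posInd S (x⁻¹ • s • β) * S.extendParam k β *
        corootC P β v) • F (weylGroup.ofIdx P β * (s * x)) := by
    rw [← Equiv.sum_comp (MulAction.toPerm s)]
    refine Finset.sum_congr rfl fun β _ => ?_
    rw [MulAction.toPerm_apply, SimpleSystem.extendParam_smul hk, corootC_smul,
      weylAction_ofIdx_ofIdx, tOp_apply, hsi, ofIdx_reflection, ← hs]
    congr 2
    rw [← mul_assoc, ← mul_assoc, ← mul_assoc, hss, one_mul, mul_assoc]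
  rw [h2, h1, add_sub_add_left_eq_sub, ← Finset.sum_sub_distrib]
  simp only [← sub_smul]
  have hne : (negIdx P (i : ι)) ≠ i := negIdx_ne _
  rw [← Finset.sum_subset (Finset.subset_univ {(i : ι), negIdx P i})]
  · rw [Finset.sum_pair hne.symm]
    have h3 : weylGroup.ofIdx P (i : ι) * (s * x) = x := by rw [← mul_assoc, hss, one_mul]
    have h4 : s • (i : ι) = negIdx P i := rfl
    have h5 : s • negIdx P (i : ι) = i := by rw [← h4, smul_smul, hss, one_smul]
    have h6 : (s * x)⁻¹ • (i : ι) = negIdx P (x⁻¹ • (i : ι)) := by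
      rw [mul_inv_rev, hsi, mul_smul, h4, smul_negIdx]
    have h7 : posInd S (i : ι) = 1 := if_pos (SimpleSystem.isPos_of_mem i.2)
    have h8 : S.extendParam k (negIdx P (i : ι)) = k i := by
      rw [negIdx, SimpleSystem.extendParam_smul hk, SimpleSystem.extendParam_coe hk]
    rw [ofIdx_negIdx, h3, ← add_smul, h5, h4, h8, SimpleSystem.extendParam_coe hk, smul_negIdx,
      smul_negIdx, h6, corootC_negIdx, negIdx_negIdx, posInd_negIdx, posInd_negIdx, h7]
    congr 1
    ring
  · intro β _ hβ
    simp only [Finset.mem_insert, Finset.mem_singleton, not_or] at hβ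
    rw [posInd_simple_smul i.2 hβ.1 hβ.2, mul_inv_rev, hsi, mul_smul, sub_self, zero_smul]

lemma fOp_delta_one (v : ℂ ⊗[ℝ] V₀) (p : MvPolynomial σ ℂ) :
    fOp S k b v (delta 1 p) = delta 1 (linForm b v * p) := by
  classical
  funext x
  rw [fOp_apply, Finset.sum_eq_zero, add_zero]
  · simp only [delta, Pi.single_apply]
    split_ifs with h
    · rw [h, inv_one, weylAction_one]
    · simp
  · intro β _
    simp only [delta, Pi.single_apply]
    split_ifs with h
    · have hx : x⁻¹ = weylGroup.ofIdx P β := inv_eq_of_mul_eq_one_left h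
      rw [hx, show weylGroup.ofIdx P β • β = negIdx P β from rfl, posInd_mul_posInd_negIdx]
      simp
    · simp

lemma eq_sum_delta (F : Carrier P σ) : F = ∑ w, delta w (F w) := by
  classical
  exact (Finset.univ_sum_single F).symm

/-- On `delta 1 p` the operators are multiplications, hence commute. Moving both past `T_s` with
`tOp_fOp` carries commutativity from `w` to `s w`: the extra terms of the commutator are multiples
of `D_α` with coefficients `∓ k_α ⟨v, α^∨⟩⟨v', α^∨⟩`, and they cancel. -/
lemma fOp_comm [P.IsReduced] (hk : IsParameterFunction S k) (v v' : ℂ ⊗[ℝ] V₀) :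
    fOp S k b v * fOp S k b v' = fOp S k b v' * fOp S k b v := by
  let D := fOp S k b
  have key : ∀ (w : P.weylGroup) (p : MvPolynomial σ ℂ) (v v' : ℂ ⊗[ℝ] V₀),
      D v (D v' (delta w p)) = D v' (D v (delta w p)) := by
    intro w p
    induction w using SimpleSystem.weylGroup_induction S with
    | one =>
      intro v v'
      simp only [D, fOp_delta_one]
      rw [mul_left_comm]
    | mul i hi w ih =>
      intro v v'
      have hT : ∀ v G, D v (tOp P σ (weylGroup.ofIdx P i) G) =
          tOp P σ (weylGroup.ofIdx P i) (D (weylAction P (weylGroup.ofIdx P i) v) G) +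
            (k ⟨i, hi⟩ * corootC P i v) • G := by
        intro v G
        have := LinearMap.congr_fun
          (tOp_fOp b hk ⟨i, hi⟩ (weylAction P (weylGroup.ofIdx P i) v)) G
        simp only [LinearMap.sub_apply, Module.End.mul_apply, Module.algebraMap_end_apply,
          weylAction_ofIdx_ofIdx, corootC_weylAction_self] at this
        rw [sub_eq_iff_eq_add] at this
        rw [this]
        module
      rw [← tOp_delta, hT, hT]
      simp only [map_add, hT, map_smul]
      rw [ih]
      simp only [weylAction_ofIdx, map_sub, map_smul, LinearMap.sub_apply, LinearMap.smul_apply]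
      module
  refine LinearMap.ext fun F => ?_
  rw [eq_sum_delta F]
  simp only [map_sum]
  exact Finset.sum_congr rfl fun w _ => key w _ v v'

variable (S k)

/-- The action of `ℍ` on the PBW module `ℂ[W] ⊗ S(V)`. -/
def rep [P.IsReduced] (hk : IsParameterFunction S k) :
    HeckeAlgebra S k →ₐ[ℂ] Module.End ℂ (Carrier P σ) :=
  HeckeAlgebra.lift (tOp P σ) (fOp S k b) (fOp_comm b hk) (tOp_fOp b hk)

variable {S k}

lemma rep_polyHom_delta [P.IsReduced] (hk : IsParameterFunction S k) (p q : MvPolynomial σ ℂ) :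
    rep S k b hk (polyHom S k b p) (delta 1 q) = delta 1 (p * q) := by
  classical
  induction p using MvPolynomial.induction_on generalizing q with
  | C a =>
    rw [show MvPolynomial.C a = algebraMap ℂ (MvPolynomial σ ℂ) a from rfl, AlgHom.commutes,
      AlgHom.commutes, Module.algebraMap_end_apply, ← Algebra.smul_def]
    exact (Pi.single_smul (f := fun _ : P.weylGroup => MvPolynomial σ ℂ) 1 a q).symm
  | add p p' hp hp' =>
    rw [map_add, map_add, LinearMap.add_apply, hp, hp', add_mul]
    exact (Pi.single_add (f := fun _ : P.weylGroup => MvPolynomial σ ℂ) 1 _ _).symm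
  | mul_X p i hp =>
    rw [map_mul, map_mul, Module.End.mul_apply, polyHom_X]
    have : rep S k b hk (HeckeAlgebra.f S k (b i)) = fOp S k b (b i) :=
      HeckeAlgebra.lift_f _ _ _ _ _
    rw [this, fOp_delta_one, hp, linForm_basis, mul_assoc]

/-- This is the independence half of PBW: applying `h` to the cyclic vector `delta 1 1` reads off
the coordinates of `h` with respect to the products `t_w p`. -/
lemma rep_t_mul_polyHom [P.IsReduced] (hk : IsParameterFunction S k) (w : P.weylGroup)
    (p : MvPolynomial σ ℂ) :
    rep S k b hk (HeckeAlgebra.t S k w * polyHom S k b p) (delta 1 1) = delta w p := by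
  rw [map_mul, Module.End.mul_apply, rep_polyHom_delta, mul_one]
  have : rep S k b hk (HeckeAlgebra.t S k w) = tOp P σ w :=
      HeckeAlgebra.lift_t _ _ _ _ _
  rw [this, tOp_delta, mul_one]

variable (S k) in
/-- The products `t_w p` span `ℍ`. -/
lemma span_t_mul_polyHom [P.IsReduced] :
    Submodule.span ℂ (Set.range fun x : P.weylGroup × MvPolynomial σ ℂ =>
      HeckeAlgebra.t S k x.1 * polyHom S k b x.2) = ⊤ := by
  set M := Submodule.span ℂ (Set.range fun x : P.weylGroup × MvPolynomial σ ℂ =>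
      HeckeAlgebra.t S k x.1 * polyHom S k b x.2) with hM
  have hmem : ∀ w p, HeckeAlgebra.t S k w * polyHom S k b p ∈ M :=
    fun w p => Submodule.subset_span ⟨(w, p), rfl⟩
  have hmul : ∀ {a : HeckeAlgebra S k}, (∀ w p, a * (HeckeAlgebra.t S k w * polyHom S k b p) ∈ M) →
      ∀ m ∈ M, a * m ∈ M := by
    intro a ha m hm
    induction hm using Submodule.span_induction with
    | mem x hx => obtain ⟨⟨w, p⟩, rfl⟩ := hx; exact ha w p
    | zero => rw [mul_zero]; exact zero_mem _
    | add x y _ _ hx hy => rw [mul_add]; exact add_mem hx hy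
    | smul c x _ hx => rw [mul_smul_comm]; exact M.smul_mem c hx
  have ht : ∀ u, ∀ m ∈ M, HeckeAlgebra.t S k u * m ∈ M := fun u =>
    hmul fun w p => by rw [← mul_assoc, ← map_mul]; exact hmem _ _
  -- The vector `v` is pushed to the right through `t_w` one simple reflection at a time; each
  -- crossing leaves a scalar multiple of a shorter product already in `M`.
  have hf : ∀ w p v, HeckeAlgebra.f S k v * (HeckeAlgebra.t S k w * polyHom S k b p) ∈ M := by
    intro w p
    induction w using SimpleSystem.weylGroup_induction S with
    | one =>
      intro v
      have := hmem 1 (linForm b v * p)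
      rw [map_mul, polyHom_linForm, map_one, one_mul] at this
      rwa [map_one, one_mul]
    | mul i hi w ih =>
      intro v
      rw [map_mul, mul_assoc, ← mul_assoc, HeckeAlgebra.f_mul_t S k ⟨i, hi⟩, add_mul, mul_assoc,
        ← Algebra.smul_def]
      exact add_mem (ht _ _ (ih _)) (M.smul_mem _ (hmem _ _))
  have hall : ∀ h : HeckeAlgebra S k, ∀ m ∈ M, h * m ∈ M := by
    intro h
    induction h using HeckeAlgebra.induction_gen with
    | hC c => intro m hm; rw [← Algebra.smul_def]; exact M.smul_mem c hm
    | ht w => exact ht w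
    | hf v => exact hmul fun w p => hf w p v
    | hmul a b ha hb => intro m hm; rw [mul_assoc]; exact ha _ (hb m hm)
    | hadd a b ha hb => intro m hm; rw [add_mul]; exact add_mem (ha m hm) (hb m hm)
  rw [eq_top_iff]
  intro h _
  have h1 : (1 : HeckeAlgebra S k) ∈ M := by
    have := hmem 1 1
    rwa [map_one, map_one, mul_one] at this
  have := hall h 1 h1
  rwa [mul_one] at this

variable (S k) in
lemma linearMap_ext [P.IsReduced] {U : Type*} [AddCommGroup U] [Module ℂ U]
    {φ ψ : HeckeAlgebra S k →ₗ[ℂ] U}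
    (h : ∀ w p, φ (HeckeAlgebra.t S k w * polyHom S k b p) =
      ψ (HeckeAlgebra.t S k w * polyHom S k b p)) : φ = ψ :=
  LinearMap.ext_on_range (span_t_mul_polyHom S k b) fun x => h x.1 x.2

/-- By the PBW theorem, linear maps on `ℍ` can be prescribed on the products `t_w p`. -/
lemma exists_linearMap [P.IsReduced] (hk : IsParameterFunction S k) {U : Type*} [AddCommGroup U]
    [Module ℂ U] (g : P.weylGroup → MvPolynomial σ ℂ →ₗ[ℂ] U) :
    ∃ φ : HeckeAlgebra S k →ₗ[ℂ] U, ∀ w p,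
      φ (HeckeAlgebra.t S k w * polyHom S k b p) = g w p := by
  classical
  let L : Carrier P σ →ₗ[ℂ] U := LinearMap.lsum ℂ (fun _ => MvPolynomial σ ℂ) ℂ g
  refine ⟨L ∘ₗ LinearMap.applyₗ (delta 1 1) ∘ₗ (rep S k b hk).toLinearMap, fun w p => ?_⟩
  change L (rep S k b hk _ (delta 1 1)) = _
  rw [rep_t_mul_polyHom, delta]
  convert LinearMap.lsum_piSingle (S := ℂ) (f := g) (i := w) (x := p)

end PBW

/-! ### The Koszul differential on alternating maps. -/

namespace Koszul

open AlternatingMap (curryLeft curryLeft_apply_apply curryLeft_same curryLeft_add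
  curryLeftLinearMap curryLeftLinearMap_apply curryLeft_compLinearMap alternatizeUncurryFin
  alternatizeUncurryFin_apply compLinearMap_apply map_insertNth)

section Basic

variable {K V F F' : Type*} [CommRing K] [AddCommGroup V] [Module K V] [AddCommGroup F] [Module K F]
  [AddCommGroup F'] [Module K F'] {n : ℕ}

/-- Comparing forms through their contractions `ι_e` allows identities to be proved by induction on
the degree. -/
lemma ext_curryLeft {f g : V [⋀^Fin (n + 1)]→ₗ[K] F}
    (h : ∀ e, f.curryLeft e = g.curryLeft e) : f = g := by
  ext v
  have := DFunLike.congr_fun (h (v 0)) (Matrix.vecTail v)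
  rw [curryLeft_apply_apply, curryLeft_apply_apply] at this
  have hv : Matrix.vecCons (v 0) (Matrix.vecTail v) = v := Matrix.cons_head_tail v
  rwa [hv] at this

lemma curryLeft_curryLeft_swap (f : V [⋀^Fin (n + 2)]→ₗ[K] F) (x y : V) :
    (f.curryLeft x).curryLeft y = -(f.curryLeft y).curryLeft x := by
  have h := curryLeft_same f (x + y)
  simp only [map_add, curryLeft_add, LinearMap.add_apply, curryLeft_same, zero_add, add_zero] at h
  rw [add_comm] at h
  exact eq_neg_iff_add_eq_zero.mpr h

lemma curryLeft_sub (f g : V [⋀^Fin (n + 1)]→ₗ[K] F) (e : V) :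
    (f - g).curryLeft e = f.curryLeft e - g.curryLeft e := rfl

/-- The Koszul differential on alternating maps with values in a module on which `V` acts by the
operators `A v`. -/
def d (A : V →ₗ[K] Module.End K F) :
    (V [⋀^Fin n]→ₗ[K] F) →ₗ[K] (V [⋀^Fin (n + 1)]→ₗ[K] F) where
  toFun ω := alternatizeUncurryFin
    { toFun := fun v => (A v).compAlternatingMap ω
      map_add' := fun v v' => by rw [map_add, LinearMap.add_compAlternatingMap]
      map_smul' := fun c v => by ext; simp }
  map_add' ω ω' := by
    ext v; simp [alternatizeUncurryFin_apply, Finset.sum_add_distrib]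
  map_smul' c ω := by
    ext v; simp [alternatizeUncurryFin_apply, Finset.smul_sum, smul_comm c]

variable (A : V →ₗ[K] Module.End K F) (A' : V →ₗ[K] Module.End K F')

lemma d_apply (ω : V [⋀^Fin n]→ₗ[K] F) (v : Fin (n + 1) → V) :
    d A ω v = ∑ i : Fin (n + 1), (-1) ^ (i : ℕ) • A (v i) (ω (i.removeNth v)) :=
  alternatizeUncurryFin_apply _ _

lemma curryLeft_d_zero (ω : V [⋀^Fin 0]→ₗ[K] F) (e : V) :
    (d A ω).curryLeft e = (A e).compAlternatingMap ω := by
  ext v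
  rw [curryLeft_apply_apply, d_apply]
  rw [Fin.sum_univ_succ, Fin.sum_univ_zero, add_zero, Fin.val_zero, pow_zero, one_smul]
  rfl

/-- Cartan's formula `ι_e d + d ι_e = A_e`. -/
lemma curryLeft_d (ω : V [⋀^Fin (n + 1)]→ₗ[K] F) (e : V) :
    (d A ω).curryLeft e = (A e).compAlternatingMap ω - d A (ω.curryLeft e) := by
  ext v
  rw [curryLeft_apply_apply, d_apply, Fin.sum_univ_succ, AlternatingMap.sub_apply, d_apply, sub_eq_add_neg,
    ← Finset.sum_neg_distrib]
  congr 1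
  · simp only [Fin.val_zero, pow_zero, one_smul, Matrix.cons_val_zero]
    rfl
  · refine Finset.sum_congr rfl fun i _ => ?_
    have : (i.succ).removeNth (Matrix.vecCons e v) = Matrix.vecCons e (i.removeNth v) := by
      funext j
      refine Fin.cases ?_ (fun j => ?_) j
      · rfl
      · simp [Fin.removeNth]
    rw [this, curryLeft_apply_apply, Matrix.cons_val_succ, Fin.val_succ, pow_succ, mul_neg_one,
      neg_smul]

variable {A A'} in
lemma d_naturality (T : F →ₗ[K] F') (hT : ∀ v x, T (A v x) = A' v (T x))
    (ω : V [⋀^Fin n]→ₗ[K] F) :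
    T.compAlternatingMap (d A ω) = d A' (T.compAlternatingMap ω) := by
  ext v
  rw [LinearMap.compAlternatingMap_apply, d_apply, d_apply, map_sum]
  refine Finset.sum_congr rfl fun i _ => ?_
  rw [map_zsmul, hT]; rfl

variable {A} in
-- By Cartan's formula twice, `ι_e d d ω = A_e d ω - d A_e ω + d d ι_e ω`. The first two terms
-- cancel because `A_e` commutes with every `A_v`, and the last vanishes by induction.
lemma d_d (hA : ∀ v w x, A v (A w x) = A w (A v x)) (ω : V [⋀^Fin n]→ₗ[K] F) :
    d A (d A ω) = 0 := by
  induction n with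
  | zero =>
    refine ext_curryLeft fun e => ?_
    rw [curryLeft_d, curryLeft_d_zero, d_naturality (A e) (hA e), sub_self]; rfl
  | succ n ih =>
    refine ext_curryLeft fun e => ?_
    rw [curryLeft_d, curryLeft_d, map_sub, ih, d_naturality (A e) (hA e), sub_zero, sub_self]; rfl

variable (F) in
/-- A linear form acting by scalars; its Koszul differential is the wedge product. -/
def scalarOp (a : V →ₗ[K] K) : V →ₗ[K] Module.End K F :=
  (LinearMap.lsmul K F) ∘ₗ a

lemma scalarOp_comp (a : V →ₗ[K] K) (e : V) (ω : V [⋀^Fin n]→ₗ[K] F) :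
    (scalarOp F a e).compAlternatingMap ω = a e • ω := rfl

/-- Since `s - 1` has rank one, the expansion of `s^* ω` stops at first order: `s^* ω = ω - a ∧ ι_α
ω`. -/
lemma compLinearMap_reflection {a : V →ₗ[K] K} {α : V} {s : V →ₗ[K] V}
    (hs : ∀ v, s v = v - a v • α) (ω : V [⋀^Fin (n + 1)]→ₗ[K] F) :
    ω.compLinearMap s = ω - d (scalarOp F a) (ω.curryLeft α) := by
  induction n with
  | zero =>
    refine ext_curryLeft fun e => ?_
    rw [curryLeft_compLinearMap, curryLeft_sub, curryLeft_d_zero, scalarOp_comp, hs,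
      map_sub, map_smul]
    ext v
    rw [compLinearMap_apply]
    congr 1
    exact Subsingleton.elim _ _
  | succ n ih =>
    refine ext_curryLeft fun e => ?_
    rw [curryLeft_compLinearMap, curryLeft_sub, curryLeft_d, scalarOp_comp, ih, hs,
      map_sub, map_smul]
    have h1 : (ω.curryLeft e - a e • ω.curryLeft α).curryLeft α = (ω.curryLeft e).curryLeft α := by
      rw [curryLeft_sub, AlternatingMap.curryLeft_smul, LinearMap.smul_apply, curryLeft_same,
        smul_zero, sub_zero]
    rw [h1]
    rw [curryLeft_curryLeft_swap ω e α, map_neg]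
    abel

/-- A consequence of `a ∧ a = 0`. It removes the parameter-dependent error in `d_mem_koszulTerm`. -/
lemma wedge_compLinearMap_reflection {a : V →ₗ[K] K} {α : V} {s : V →ₗ[K] V}
    (hs : ∀ v, s v = v - a v • α) (ω : V [⋀^Fin n]→ₗ[K] F) :
    d (scalarOp F a) (ω.compLinearMap s) = d (scalarOp F a) ω := by
  cases n with
  | zero =>
    congr 1
    ext v
    rw [compLinearMap_apply]
    congr 1
    exact Subsingleton.elim _ _
  | succ n =>
    rw [compLinearMap_reflection hs, map_sub, d_d, sub_zero]
    intro v w x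
    exact smul_comm (a v) (a w) x

end Basic

/-! ### Exactness for coregular sequences of operators. -/

section Exactness

variable {K V F : Type*} [Field K] [AddCommGroup V] [Module K V] [AddCommGroup F] [Module K F]
  {A : V →ₗ[K] Module.End K F} {n m : ℕ}

lemma curryLeft_d_eq_of_curryLeft_eq_zero (η : V [⋀^Fin n]→ₗ[K] F) (e : V)
    (h : ∀ v : Fin n → V, (∃ i, v i = e) → η v = 0) :
    (d A η).curryLeft e = (A e).compAlternatingMap η := by
  cases n with
  | zero => exact curryLeft_d_zero A η e
  | succ n =>
    rw [curryLeft_d, show η.curryLeft e = 0 from ?_, map_zero, sub_zero]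
    ext v
    exact h _ ⟨0, rfl⟩

/-- Exactness of the Koszul complex for a coregular sequence of operators. -/
theorem exists_d_eq (hA : ∀ v w x, A v (A w x) = A w (A v x)) (e : Fin m → V)
    (he : Submodule.span K (Set.range e) = ⊤)
    (hsurj : ∀ (j : Fin m) (g : F), (∀ i < j, A (e i) g = 0) →
      ∃ f, (∀ i < j, A (e i) f = 0) ∧ A (e j) f = g)
    (ω : V [⋀^Fin (n + 1)]→ₗ[K] F) (hω : d A ω = 0) : ∃ η, d A η = ω := by
  -- The form is corrected by coboundaries until its contractions with `e 0, …, e (j - 1)` vanish;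
  -- at `j = m` these vectors span, so the difference is zero.
  have key : ∀ j ≤ m, ∃ η, ∀ i : Fin m, (i : ℕ) < j → (ω - d A η).curryLeft (e i) = 0 := by
    intro j
    induction j with
    | zero => exact fun _ => ⟨0, fun i hi => absurd hi (Nat.not_lt_zero _)⟩
    | succ j ih =>
      intro hj
      obtain ⟨η, hη⟩ := ih (Nat.le_of_succ_le hj)
      set ω' := ω - d A η with hω'
      have hcl : d A ω' = 0 := by rw [hω', map_sub, hω, d_d hA, sub_zero]
      let j' : Fin m := ⟨j, hj⟩
      let N : Submodule K F := ⨅ i : Set.Iio j', LinearMap.ker (A (e i))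
      have hN : ∀ x, x ∈ N ↔ ∀ i < j', A (e i) x = 0 := by
        intro x
        simp [N, Submodule.mem_iInf]
      -- Since `ω'` is closed and `ι_{e i} ω' = 0`, Cartan's formula gives `A (e i) ω' = 0`.
      have hωN : ∀ v, ω' v ∈ N := by
        intro v
        rw [hN]
        intro i hi
        have h1 := curryLeft_d A ω' (e i)
        rw [hη i hi, map_zero, hcl, sub_zero] at h1
        exact (DFunLike.congr_fun h1 v).symm
      let T : N →ₗ[K] N := (A (e j')).restrict (p := N) (q := N) (by
        intro x hx
        rw [hN] at hx ⊢
        intro i hi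
        rw [hA, hx i hi, map_zero])
      have hT : LinearMap.range T = ⊤ := by
        rw [LinearMap.range_eq_top]
        rintro ⟨g, hg⟩
        obtain ⟨f, hf, hfg⟩ := hsurj j' g ((hN g).mp hg)
        exact ⟨⟨f, (hN f).mpr hf⟩, Subtype.ext hfg⟩
      -- A linear section of `A (e j)` on `N` applied to `ι_{e j} ω'` gives the correction `η'`. It
      -- vanishes as soon as an argument is some `e i` with `i ≤ j`, so `ι_{e i} d η' = A (e i) η'`:
      -- this is `0` for `i < j` and `ι_{e j} ω'` for `i = j`.
      obtain ⟨σ, hσ⟩ := T.exists_rightInverse_of_surjective hT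
      let θ : V [⋀^Fin n]→ₗ[K] N := (ω'.curryLeft (e j')).codRestrict N fun v => hωN _
      let η' : V [⋀^Fin n]→ₗ[K] F := (N.subtype ∘ₗ σ).compAlternatingMap θ
      have hη'N : ∀ v, η' v ∈ N := fun v => (σ (θ v)).2
      have hη'z : ∀ i : Fin m, (i : ℕ) < j + 1 → ∀ v : Fin n → V, (∃ l, v l = e i) → η' v = 0 := by
        rintro i hi v ⟨l, hl⟩
        have : θ v = 0 := by
          apply Subtype.ext
          change ω' (Matrix.vecCons (e j') v) = 0
          rcases Nat.lt_succ_iff_lt_or_eq.mp hi with hi | hi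
          · have h0 := map_insertNth (ω') (l.succ) (e i) (l.succ.removeNth (Matrix.vecCons (e j') v))
            have h1 : l.succ.insertNth (e i) (l.succ.removeNth (Matrix.vecCons (e j') v)) =
                Matrix.vecCons (e j') v := by
              rw [Fin.insertNth_removeNth]
              rw [← hl]
              exact Function.update_eq_self (l.succ) (Matrix.vecCons (e j') v)
            rw [h1] at h0
            rw [h0, ← curryLeft_apply_apply, hη i hi]
            simp
          · have : e i = e j' := congrArg e (Fin.ext hi)
            exact ω'.map_eq_zero_of_eq _ (i := 0) (j := l.succ)
              (by simp [hl, this]) (Fin.succ_ne_zero l).symm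
        change ((σ (θ v) : N) : F) = 0
        rw [this, map_zero]; rfl
      refine ⟨η + η', fun i hi => ?_⟩
      rw [map_add, ← sub_sub, ← hω', curryLeft_sub,
        curryLeft_d_eq_of_curryLeft_eq_zero η' (e i) (hη'z i hi)]
      rcases Nat.lt_succ_iff_lt_or_eq.mp hi with hi | hi
      · rw [hη i hi, zero_sub, neg_eq_zero]
        ext v
        exact (hN _).mp (hη'N v) i hi
      · have : i = j' := Fin.ext hi
        subst this
        rw [sub_eq_zero]
        ext v
        have := congrArg Subtype.val (LinearMap.congr_fun hσ (θ v))
        exact this.symm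
  obtain ⟨η, hη⟩ := key m le_rfl
  refine ⟨η, ?_⟩
  rw [eq_comm, ← sub_eq_zero]
  refine ext_curryLeft fun v => ?_
  have hv : v ∈ Submodule.span K (Set.range e) := he ▸ Submodule.mem_top
  have h0 : curryLeft (0 : V [⋀^Fin (n + 1)]→ₗ[K] F) v = 0 := rfl
  rw [h0]
  induction hv using Submodule.span_induction with
  | mem x hx => obtain ⟨i, rfl⟩ := hx; exact hη i i.2
  | zero => rw [map_zero]
  | add x y _ _ hx hy => rw [map_add, hx rfl, hy rfl, add_zero]
  | smul c x _ hx => rw [map_smul, hx rfl, smul_zero]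

end Exactness

/-! ### Coregularity on the dual of a polynomial ring. -/

section PowerSeries

variable {K Y : Type*} [Field K] [AddCommGroup Y] [Module K Y] {m : ℕ}

/-- The twisted difference operators on the dual of a polynomial ring form a coregular sequence. -/
lemma exists_coregular (y : Fin m → Module.End K Y) (hy : ∀ i j x, y i (y j x) = y j (y i x))
    (j : Fin m) (g : MvPolynomial (Fin m) K →ₗ[K] Y)
    (hg : ∀ i < j, ∀ p, y i (g p) - g (MvPolynomial.X i * p) = 0) :
    ∃ f : MvPolynomial (Fin m) K →ₗ[K] Y,
      (∀ i < j, ∀ p, y i (f p) - f (MvPolynomial.X i * p) = 0) ∧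
      ∀ p, y j (f p) - f (MvPolynomial.X j * p) = g p := by
  classical
  let x : (Fin m →₀ ℕ) → MvPolynomial (Fin m) K := fun s => MvPolynomial.monomial s 1
  have hx : ∀ i s, MvPolynomial.X i * x s = x (s + Finsupp.single i 1) := by
    intro i s
    simp only [x, MvPolynomial.X, MvPolynomial.monomial_mul, mul_one, add_comm]
  -- The equation `f (X_j p) = y_j (f p) - g p` is a recursion in the exponent of `X_j`. Here `u a
  -- s` is its solution after `a` steps from the exponent `s`, with initial value `0`, which is
  -- compatible with the conditions for `i < j`.
  let u : ℕ → (Fin m →₀ ℕ) → Y := fun a s =>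
    Nat.rec 0 (fun b r => y j r - g (x (s + Finsupp.single j b))) a
  have hu0 : ∀ s, u 0 s = 0 := fun s => rfl
  have hu1 : ∀ a s, u (a + 1) s = y j (u a s) - g (x (s + Finsupp.single j a)) := fun a s => rfl
  have hui : ∀ i < j, ∀ a s, u a (s + Finsupp.single i 1) = y i (u a s) := by
    intro i hi a s
    induction a with
    | zero => rw [hu0, hu0, map_zero]
    | succ a ih =>
      rw [hu1, hu1, ih, map_sub, hy]
      congr 1
      rw [add_right_comm, ← hx, ← sub_eq_zero.mp (hg i hi _)]
  let f : MvPolynomial (Fin m) K →ₗ[K] Y :=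
    (MvPolynomial.basisMonomials (Fin m) K).constr K fun s => u (s j) (s.erase j)
  have hf : ∀ s, f (x s) = u (s j) (s.erase j) := fun s => by
    have : x s = MvPolynomial.basisMonomials (Fin m) K s := by simp [x]
    rw [this]
    exact (MvPolynomial.basisMonomials (Fin m) K).constr_basis K _ s
  have hext : ∀ φ ψ : MvPolynomial (Fin m) K →ₗ[K] Y, (∀ s, φ (x s) = ψ (x s)) → ∀ p, φ p = ψ p := by
    intro φ ψ h p
    have : φ = ψ := (MvPolynomial.basisMonomials (Fin m) K).ext fun s => by simpa [x] using h s
    rw [this]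
  refine ⟨f, fun i hi p => sub_eq_zero.mpr ?_, fun p => ?_⟩
  · refine hext (y i ∘ₗ f) (f ∘ₗ LinearMap.mulLeft K (MvPolynomial.X i)) (fun s => ?_) p
    simp only [LinearMap.comp_apply, LinearMap.mulLeft_apply]
    rw [hx, hf, hf, ← hui i hi]
    have hij : i ≠ j := hi.ne
    congr 1
    · simp [hij]
    · rw [Finsupp.erase_add, Finsupp.erase_single_ne hij.symm]
  · refine hext (y j ∘ₗ f - f ∘ₗ LinearMap.mulLeft K (MvPolynomial.X j)) g (fun s => ?_) p
    simp only [LinearMap.comp_apply, LinearMap.mulLeft_apply, LinearMap.sub_apply]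
    rw [hx, hf, hf, Finsupp.erase_add, Finsupp.erase_single, add_zero, Finsupp.add_apply,
      Finsupp.single_eq_same, hu1, sub_sub_cancel, Finsupp.erase_add_single]

end PowerSeries

end Koszul

/-! ### The coinduced module `Hom_K(H, Y)`. -/

/-- The coinduced module of linear maps `H → Y`, on which `H` acts by right translations. -/
def CoFun (K H Y : Type*) [CommRing K] [Ring H] [Algebra K H] [AddCommGroup Y] [Module K Y] :
    Type _ := H →ₗ[K] Y

namespace CoFun

variable {K H Y : Type*} [CommRing K] [Ring H] [Algebra K H] [AddCommGroup Y] [Module K Y]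

instance : AddCommGroup (CoFun K H Y) := inferInstanceAs (AddCommGroup (H →ₗ[K] Y))
instance : Module K (CoFun K H Y) := inferInstanceAs (Module K (H →ₗ[K] Y))
instance : FunLike (CoFun K H Y) H Y := inferInstanceAs (FunLike (H →ₗ[K] Y) H Y)
instance : LinearMapClass (CoFun K H Y) K H Y :=
  inferInstanceAs (LinearMapClass (H →ₗ[K] Y) K H Y)

@[ext] lemma ext {φ ψ : CoFun K H Y} (h : ∀ x, φ x = ψ x) : φ = ψ := LinearMap.ext h

@[simp] lemma add_apply (φ ψ : CoFun K H Y) (x : H) : (φ + ψ) x = φ x + ψ x := rfl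
@[simp] lemma zero_apply (x : H) : (0 : CoFun K H Y) x = 0 := rfl
@[simp] lemma smul_apply (c : K) (φ : CoFun K H Y) (x : H) : (c • φ) x = c • φ x := rfl

/-- Regard a linear map as an element of the coinduced module. -/
def ofLinearMap : (H →ₗ[K] Y) ≃ₗ[K] CoFun K H Y := LinearEquiv.refl K _

@[simp] lemma ofLinearMap_apply (φ : H →ₗ[K] Y) (x : H) : ofLinearMap φ x = φ x := rfl

/-- Evaluation at a point. -/
def eval (x : H) : CoFun K H Y →ₗ[K] Y := LinearMap.applyₗ x

@[simp] lemma eval_apply (x : H) (φ : CoFun K H Y) : eval x φ = φ x := rfl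

instance : Module H (CoFun K H Y) where
  smul h φ := ofLinearMap ((ofLinearMap.symm φ) ∘ₗ LinearMap.mulRight K h)
  one_smul φ := by ext x; exact congrArg φ (mul_one x)
  mul_smul a b φ := by ext x; exact congrArg φ (mul_assoc x a b).symm
  smul_zero a := rfl
  smul_add a φ ψ := rfl
  add_smul a b φ := by ext x; exact (congrArg φ (mul_add x a b)).trans (map_add φ _ _)
  zero_smul φ := by ext x; exact (congrArg φ (mul_zero x)).trans (map_zero φ)

@[simp] lemma alg_smul_apply (a : H) (φ : CoFun K H Y) (x : H) : (a • φ) x = φ (x * a) := rfl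

instance : IsScalarTower K H (CoFun K H Y) where
  smul_assoc c a φ := by
    ext x
    rw [alg_smul_apply, mul_smul_comm, map_smul]; rfl

end CoFun

/-! ### The Koszul coresolution of `Y`. -/

section Complex

open RootPairing

variable {ι V₀ N : Type u} [AddCommGroup V₀] [Module ℝ V₀] [AddCommGroup N] [Module ℝ N]
  {P : RootPairing ι ℝ V₀ N} (S : SimpleSystem P) (k : S.support → ℂ)
  (Y : Type u) [AddCommGroup Y] [Module ℂ Y]

section

variable {m : ℕ} (b : Module.Basis (Fin m) ℂ (ℂ ⊗[ℝ] V₀))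

/-- Restriction of functions on `ℍ` to polynomials. -/
def polyRes : CoFun ℂ (HeckeAlgebra S k) Y →ₗ[ℂ] (MvPolynomial (Fin m) ℂ →ₗ[ℂ] Y) :=
  (LinearMap.lcomp ℂ Y (PBW.polyHom S k b).toLinearMap) ∘ₗ CoFun.ofLinearMap.symm.toLinearMap

variable {S k Y} in
lemma polyRes_apply (φ : CoFun ℂ (HeckeAlgebra S k) Y) (p : MvPolynomial (Fin m) ℂ) :
    polyRes S k Y b φ p = φ (PBW.polyHom S k b p) := rfl

end

variable [Module (HeckeAlgebra S k) Y]

/-- The `n`-th term of the Koszul coresolution of `Y`: the `W`-equivariant alternating forms with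
values in the coinduced module. -/
def koszulTerm (n : ℕ) : Submodule (HeckeAlgebra S k)
    ((ℂ ⊗[ℝ] V₀) [⋀^Fin n]→ₗ[ℂ] CoFun ℂ (HeckeAlgebra S k) Y) where
  carrier := {ω | ∀ (w : P.weylGroup) v h, ω v (HeckeAlgebra.t S k w * h) =
    HeckeAlgebra.t S k w • ω (fun i => weylAction P w⁻¹ (v i)) h}
  zero_mem' w v h := by simp
  add_mem' {ω ω'} hω hω' w v h := by
    simp only [AlternatingMap.add_apply, CoFun.add_apply, hω w v h, hω' w v h, smul_add]
  smul_mem' a ω hω w v h := by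
    simp only [AlternatingMap.smul_apply, CoFun.alg_smul_apply, mul_assoc, hω w v (h * a)]

variable {S k Y} {n : ℕ} in
lemma koszulTerm_apply {ω : (ℂ ⊗[ℝ] V₀) [⋀^Fin n]→ₗ[ℂ] CoFun ℂ (HeckeAlgebra S k) Y}
    (hω : ω ∈ koszulTerm S k Y n) (w : P.weylGroup) (v : Fin n → ℂ ⊗[ℝ] V₀)
    (h : HeckeAlgebra S k) : ω v (HeckeAlgebra.t S k w * h) =
    HeckeAlgebra.t S k w • ω (fun i => weylAction P w⁻¹ (v i)) h := hω w v h

variable {S k Y} {n : ℕ} in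
lemma mem_koszulTerm_of_simple [P.IsReduced] [Finite ι]
    {ω : (ℂ ⊗[ℝ] V₀) [⋀^Fin n]→ₗ[ℂ] CoFun ℂ (HeckeAlgebra S k) Y}
    (hω : ∀ (i : S.support) v h, ω v (HeckeAlgebra.t S k (weylGroup.ofIdx P i) * h) =
      HeckeAlgebra.t S k (weylGroup.ofIdx P i) •
        ω (fun l => weylAction P (weylGroup.ofIdx P i) (v l)) h) : ω ∈ koszulTerm S k Y n := by
  intro w
  induction w using SimpleSystem.weylGroup_induction S with
  | one =>
    intro v h
    simp [weylAction_one]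
  | mul i hi w ih =>
    intro v h
    rw [map_mul (HeckeAlgebra.t S k), mul_assoc, hω ⟨i, hi⟩, ih, mul_smul]
    simp only [mul_inv_rev, ofIdx_inv, weylAction_mul]

variable {S k Y} {n : ℕ} in
-- Equivariance determines the values at `t_w p` from those at `p`, and the products `t_w p` span
-- `ℍ`.
lemma polyRes_injective [P.IsReduced] [Finite ι] {m : ℕ}
    (b : Module.Basis (Fin m) ℂ (ℂ ⊗[ℝ] V₀))
    {ω ω' : (ℂ ⊗[ℝ] V₀) [⋀^Fin n]→ₗ[ℂ] CoFun ℂ (HeckeAlgebra S k) Y}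
    (hω : ω ∈ koszulTerm S k Y n) (hω' : ω' ∈ koszulTerm S k Y n)
    (h : (polyRes S k Y b).compAlternatingMap ω = (polyRes S k Y b).compAlternatingMap ω') :
    ω = ω' := by
  have := Fintype.ofFinite ι
  ext1 v
  refine PBW.linearMap_ext S k b (φ := CoFun.ofLinearMap.symm (ω v))
    (ψ := CoFun.ofLinearMap.symm (ω' v)) fun w p => ?_
  change ω v _ = ω' v _
  rw [koszulTerm_apply hω, koszulTerm_apply hω']
  exact congrArg _ (congrArg (fun η => η (fun i => weylAction P w⁻¹ (v i)) p) h)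

variable [IsScalarTower ℂ (HeckeAlgebra S k) Y]

/-- The operators `A_v φ (h) = v φ(h) - φ(v h)` on the coinduced module. -/
def coOp : (ℂ ⊗[ℝ] V₀) →ₗ[ℂ] Module.End ℂ (CoFun ℂ (HeckeAlgebra S k) Y) :=
  LinearMap.mk₂ ℂ (fun v φ => CoFun.ofLinearMap
    { toFun := fun h => HeckeAlgebra.f S k v • φ h - φ (HeckeAlgebra.f S k v * h)
      map_add' := fun h h' => by rw [map_add, smul_add, mul_add, map_add]; abel
      map_smul' := fun c h => by
        rw [map_smul, smul_comm, mul_smul_comm, map_smul, smul_sub]; rfl })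
    (fun v v' φ => by
      ext h
      simp only [map_add, add_smul, add_mul, CoFun.ofLinearMap_apply, LinearMap.coe_mk,
        AddHom.coe_mk, CoFun.add_apply]; abel)
    (fun c v φ => by
      ext h
      simp only [map_smul, smul_assoc, smul_mul_assoc, CoFun.ofLinearMap_apply, LinearMap.coe_mk,
        AddHom.coe_mk, CoFun.smul_apply, smul_sub])
    (fun v φ ψ => by
      ext h
      simp only [smul_add, CoFun.ofLinearMap_apply, LinearMap.coe_mk,
        AddHom.coe_mk, CoFun.add_apply]; abel)
    (fun c v φ => by
      ext h
      simp only [CoFun.ofLinearMap_apply, LinearMap.coe_mk,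
        AddHom.coe_mk, CoFun.smul_apply, smul_sub, smul_comm _ c])

variable {S k Y}

lemma coOp_apply (v : ℂ ⊗[ℝ] V₀) (φ : CoFun ℂ (HeckeAlgebra S k) Y) (h : HeckeAlgebra S k) :
    coOp S k Y v φ h = HeckeAlgebra.f S k v • φ h - φ (HeckeAlgebra.f S k v * h) := rfl

lemma coOp_comm (v w : ℂ ⊗[ℝ] V₀) (φ : CoFun ℂ (HeckeAlgebra S k) Y) :
    coOp S k Y v (coOp S k Y w φ) = coOp S k Y w (coOp S k Y v φ) := by
  ext h
  simp only [coOp_apply, smul_sub, ← mul_smul, ← mul_assoc]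
  rw [HeckeAlgebra.f_mul_comm S k v w]
  abel

lemma coOp_smul (v : ℂ ⊗[ℝ] V₀) (a : HeckeAlgebra S k) (φ : CoFun ℂ (HeckeAlgebra S k) Y) :
    coOp S k Y v (a • φ) = a • coOp S k Y v φ := by
  ext h
  simp only [coOp_apply, CoFun.alg_smul_apply, mul_assoc]

/-- Measures how far `A_v` is from being equivariant. It is applied with `φ` a value of `ω` and `ψ`
the corresponding value of `s^* ω`. -/
lemma coOp_apply_t_mul (i : S.support) (v : ℂ ⊗[ℝ] V₀) (φ ψ : CoFun ℂ (HeckeAlgebra S k) Y)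
    (hφ : ∀ h, φ (HeckeAlgebra.t S k (weylGroup.ofIdx P i) * h) =
      HeckeAlgebra.t S k (weylGroup.ofIdx P i) • ψ h) (h : HeckeAlgebra S k) :
    coOp S k Y v φ (HeckeAlgebra.t S k (weylGroup.ofIdx P i) * h) =
      HeckeAlgebra.t S k (weylGroup.ofIdx P i) •
        coOp S k Y (weylAction P (weylGroup.ofIdx P i) v) ψ h +
      (k i * corootC P i v) • (ψ h - φ h) := by
  rw [coOp_apply, coOp_apply, hφ, ← mul_assoc, ← mul_smul, HeckeAlgebra.f_mul_t, add_smul, add_mul,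
    map_add, mul_assoc, hφ, mul_smul, smul_sub, algebraMap_smul, ← Algebra.smul_def, map_smul,
    smul_sub]
  abel

variable {n : ℕ}

/-- Simple reflections suffice. The errors from `coOp_apply_t_mul` add up to `k_α α^∨ ∧ (s^* ω -
ω)`, which is zero by `Koszul.wedge_compLinearMap_reflection`. -/
lemma d_mem_koszulTerm [P.IsReduced] [Finite ι]
    {ω : (ℂ ⊗[ℝ] V₀) [⋀^Fin n]→ₗ[ℂ] CoFun ℂ (HeckeAlgebra S k) Y}
    (hω : ω ∈ koszulTerm S k Y n) : Koszul.d (coOp S k Y) ω ∈ koszulTerm S k Y (n + 1) := by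
  refine mem_koszulTerm_of_simple fun i v h => ?_
  set s := weylGroup.ofIdx P (i : ι) with hs
  let ω' := ω.compLinearMap (weylAction P s)
  have key : ∀ l : Fin (n + 1),
      coOp S k Y (v l) (ω (l.removeNth v)) (HeckeAlgebra.t S k s * h) =
        HeckeAlgebra.t S k s • coOp S k Y (weylAction P s (v l)) (ω' (l.removeNth v)) h +
          k i • (corootC P i (v l) • (ω' (l.removeNth v) h - ω (l.removeNth v) h)) := by
    intro l
    rw [coOp_apply_t_mul i (v l) (ω (l.removeNth v)) (ω' (l.removeNth v)) (fun h => ?_) h, mul_smul]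
    have := koszulTerm_apply hω s (l.removeNth v) h
    rwa [hs, ofIdx_inv] at this
  have hw := congrArg (fun η => η v h) (Koszul.wedge_compLinearMap_reflection
    (a := corootC P (i : ι)) (α := 1 ⊗ₜ P.root (i : ι)) (weylAction_ofIdx (P := P) (i : ι)) ω)
  simp only [Koszul.d_apply] at hw ⊢
  simp only [← CoFun.eval_apply, map_sum, map_zsmul] at hw ⊢
  simp only [CoFun.eval_apply] at hw ⊢
  simp only [key, smul_add, Finset.sum_add_distrib, Finset.smul_sum]
  have h2 : ∑ l : Fin (n + 1), (-1 : ℤ) ^ (l : ℕ) •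
      k i • corootC P i (v l) • (ω' (l.removeNth v) h - ω (l.removeNth v) h) = 0 := by
    rw [← sub_eq_zero, ← Finset.sum_sub_distrib] at hw
    have := congrArg (fun y => k i • y) hw
    simp only [smul_zero, Finset.smul_sum] at this
    rw [← this]
    refine Finset.sum_congr rfl fun l _ => ?_
    rw [← smul_sub, smul_comm, smul_sub]
    rfl
  rw [h2, add_zero]
  refine Finset.sum_congr rfl fun l _ => ?_
  rw [smul_comm]
  rfl

variable (S k Y n) in
/-- The differential of the Koszul coresolution. -/
def koszulD [P.IsReduced] [Finite ι] :
    koszulTerm S k Y n →ₗ[HeckeAlgebra S k] koszulTerm S k Y (n + 1) where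
  toFun ω := ⟨Koszul.d (coOp S k Y) ω.1, d_mem_koszulTerm ω.2⟩
  map_add' ω ω' := Subtype.ext (map_add _ _ _)
  map_smul' a ω := by
    apply Subtype.ext
    ext v h
    simp only [RingHom.id_apply, Submodule.coe_smul, AlternatingMap.smul_apply,
      CoFun.alg_smul_apply]
    rw [Koszul.d_apply, Koszul.d_apply]
    simp only [AlternatingMap.smul_apply, coOp_smul, ← CoFun.eval_apply, map_sum, map_zsmul]
    simp only [CoFun.eval_apply, CoFun.alg_smul_apply]

lemma koszulD_koszulD [P.IsReduced] [Finite ι] (ω : koszulTerm S k Y n) :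
    koszulD S k Y (n + 1) (koszulD S k Y n ω) = 0 :=
  Subtype.ext (Koszul.d_d coOp_comm ω.1)

variable (S k Y) in
/-- The augmentation of the Koszul coresolution. -/
def koszulAug : Y →ₗ[HeckeAlgebra S k] koszulTerm S k Y 0 where
  toFun y := ⟨AlternatingMap.constOfIsEmpty ℂ (ℂ ⊗[ℝ] V₀) (Fin 0)
      (CoFun.ofLinearMap ((Algebra.lsmul ℂ ℂ Y).toLinearMap.flip y)), fun w v h => by
        exact mul_smul (HeckeAlgebra.t S k w) h y⟩
  map_add' y y' := by
    apply Subtype.ext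
    ext v h
    exact smul_add h y y'
  map_smul' a y := by
    apply Subtype.ext
    ext v h
    exact (mul_smul h a y).symm

lemma koszulAug_apply (y : Y) (v : Fin 0 → ℂ ⊗[ℝ] V₀) (h : HeckeAlgebra S k) :
    (koszulAug S k Y y).1 v h = h • y := rfl

lemma koszulAug_injective : Function.Injective (koszulAug S k Y) := by
  intro y y' h
  have := congrArg (fun ω => ω.1 0 (1 : HeckeAlgebra S k)) h
  simpa [koszulAug_apply] using this

/-- A closed `0`-form is a map `ℍ → Y` commuting with every `f_v`; equivariance adds the `t_w`. So
it is `ℍ`-linear, hence `h ↦ h • y` with `y` its value at `1`. -/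
lemma exact_koszulAug [P.IsReduced] [Finite ι] :
    Function.Exact (koszulAug S k Y) (koszulD S k Y 0) := by
  intro ω
  constructor
  · intro hω
    refine ⟨ω.1 0 1, ?_⟩
    have hA : ∀ v h, HeckeAlgebra.f S k v • ω.1 0 h = ω.1 0 (HeckeAlgebra.f S k v * h) := by
      intro v h
      have h1 := congrArg (fun η => η.1.curryLeft v 0 h) hω
      have h2 := Koszul.curryLeft_d_zero (coOp S k Y) ω.1 v
      have h3 : coOp S k Y v (ω.1 0) h = 0 := by
        have := congrArg (fun η => η 0 h) h2
        exact this.symm.trans h1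
      rwa [coOp_apply, sub_eq_zero] at h3
    have hall : ∀ a h : HeckeAlgebra S k, ω.1 0 (a * h) = a • ω.1 0 h := by
      intro a
      induction a using HeckeAlgebra.induction_gen with
      | hC c => intro h; rw [← Algebra.smul_def, map_smul, algebraMap_smul]
      | ht w => intro h; rw [koszulTerm_apply ω.2]; congr 2
      | hf v => intro h; exact (hA v h).symm
      | hmul a b ha hb => intro h; rw [mul_assoc, ha, hb, mul_smul]
      | hadd a b ha hb => intro h; rw [add_mul, map_add, ha, hb, add_smul]
    apply Subtype.ext
    ext v h
    rw [koszulAug_apply, ← hall, mul_one, Subsingleton.elim v 0]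
  · rintro ⟨y, rfl⟩
    apply Subtype.ext
    refine Koszul.ext_curryLeft fun e => ?_
    change (Koszul.d (coOp S k Y) _).curryLeft e = 0
    rw [Koszul.curryLeft_d_zero]
    ext v h
    change coOp S k Y e ((koszulAug S k Y y).1 v) h = 0
    rw [coOp_apply, koszulAug_apply, koszulAug_apply, mul_smul, sub_self]

/-! ### Comparison with the Koszul complex over `S(V)`. -/

section Restriction

variable {m : ℕ} (b : Module.Basis (Fin m) ℂ (ℂ ⊗[ℝ] V₀))

variable (S k Y) in
/-- The operators `f ↦ (p ↦ v f(p) - f(v p))`. -/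
def polyOp : (ℂ ⊗[ℝ] V₀) →ₗ[ℂ] Module.End ℂ (MvPolynomial (Fin m) ℂ →ₗ[ℂ] Y) :=
  LinearMap.mk₂ ℂ (fun v φ => (Algebra.lsmul ℂ ℂ Y (HeckeAlgebra.f S k v)) ∘ₗ φ -
      φ ∘ₗ LinearMap.mulLeft ℂ (PBW.linForm b v))
    (fun v v' φ => by
      ext1 s; ext1
      simp [add_mul]; abel)
    (fun c v φ => by
      ext1 s; ext1
      simp [smul_sub])
    (fun v φ ψ => by
      ext1 s; ext1
      simp; abel)
    (fun c v φ => by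
      ext1 s; ext1
      simp [smul_sub, smul_comm _ c])

lemma polyOp_apply (v : ℂ ⊗[ℝ] V₀) (φ : MvPolynomial (Fin m) ℂ →ₗ[ℂ] Y)
    (p : MvPolynomial (Fin m) ℂ) :
    polyOp S k Y b v φ p = HeckeAlgebra.f S k v • φ p - φ (PBW.linForm b v * p) := rfl

lemma polyRes_coOp (v : ℂ ⊗[ℝ] V₀) (φ : CoFun ℂ (HeckeAlgebra S k) Y) :
    polyRes S k Y b (coOp S k Y v φ) = polyOp S k Y b v (polyRes S k Y b φ) := by
  refine LinearMap.ext fun p => ?_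
  rw [polyRes_apply, coOp_apply, polyOp_apply, polyRes_apply, polyRes_apply,
    map_mul (PBW.polyHom S k b), PBW.polyHom_linForm]

lemma polyOp_comm (v w : ℂ ⊗[ℝ] V₀) (φ : MvPolynomial (Fin m) ℂ →ₗ[ℂ] Y) :
    polyOp S k Y b v (polyOp S k Y b w φ) = polyOp S k Y b w (polyOp S k Y b v φ) := by
  refine LinearMap.ext fun p => ?_
  rw [polyOp_apply, polyOp_apply, polyOp_apply, polyOp_apply, polyOp_apply, polyOp_apply,
    smul_sub, smul_sub, smul_smul, smul_smul, HeckeAlgebra.f_mul_comm S k v w,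
    mul_left_comm (PBW.linForm b v)]
  abel

/-- Equivariance forces `ω v (t_w p) = t_w • η (w⁻¹ v) p`, and PBW makes this a valid definition:
`c` is the coordinate map `ℍ → (W → S(V))`. -/
lemma polyRes_surjective [P.IsReduced] [Finite ι] (hk : IsParameterFunction S k)
    (η : (ℂ ⊗[ℝ] V₀) [⋀^Fin n]→ₗ[ℂ] (MvPolynomial (Fin m) ℂ →ₗ[ℂ] Y)) :
    ∃ ω ∈ koszulTerm S k Y n, (polyRes S k Y b).compAlternatingMap ω = η := by
  classical
  have := Fintype.ofFinite ι
  obtain ⟨c, hc⟩ := PBW.exists_linearMap b hk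
    fun w => LinearMap.single ℂ (fun _ : P.weylGroup => MvPolynomial (Fin m) ℂ) w
  let L : P.weylGroup → (MvPolynomial (Fin m) ℂ →ₗ[ℂ] Y) →ₗ[ℂ] CoFun ℂ (HeckeAlgebra S k) Y :=
    fun w => CoFun.ofLinearMap.toLinearMap ∘ₗ
      (LinearMap.lcomp ℂ Y (LinearMap.proj w ∘ₗ c)) ∘ₗ
        LinearMap.llcomp ℂ (MvPolynomial (Fin m) ℂ) Y Y
          (Algebra.lsmul ℂ ℂ Y (HeckeAlgebra.t S k w))
  let ω : (ℂ ⊗[ℝ] V₀) [⋀^Fin n]→ₗ[ℂ] CoFun ℂ (HeckeAlgebra S k) Y :=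
    ∑ w, (L w).compAlternatingMap (η.compLinearMap (weylAction P w⁻¹))
  have hL : ∀ w φ h, L w φ h = HeckeAlgebra.t S k w • φ (c h w) := fun _ _ _ => rfl
  have hωL : ∀ v h, ω v h = ∑ w, L w (η fun i => weylAction P w⁻¹ (v i)) h := by
    intro v h
    let ev : ((ℂ ⊗[ℝ] V₀) [⋀^Fin n]→ₗ[ℂ] CoFun ℂ (HeckeAlgebra S k) Y) →+ Y :=
      { toFun := fun θ => θ v h, map_zero' := rfl, map_add' := fun _ _ => rfl }
    exact map_sum ev _ _
  have hω : ∀ v w p, ω v (HeckeAlgebra.t S k w * PBW.polyHom S k b p) =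
      HeckeAlgebra.t S k w • η (fun i => weylAction P w⁻¹ (v i)) p := by
    intro v w p
    simp only [hωL, hL, hc]
    rw [Finset.sum_eq_single w]
    · simp
    · intro u _ hu
      simp [hu]
    · simp
  refine ⟨ω, fun w v h => ?_, ?_⟩
  · have := PBW.linearMap_ext S k b
      (φ := CoFun.ofLinearMap.symm (ω v) ∘ₗ LinearMap.mulLeft ℂ (HeckeAlgebra.t S k w))
      (ψ := Algebra.lsmul ℂ ℂ Y (HeckeAlgebra.t S k w) ∘ₗ
        CoFun.ofLinearMap.symm (ω fun i => weylAction P w⁻¹ (v i))) (fun u p => by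
        change ω v (HeckeAlgebra.t S k w * _) = HeckeAlgebra.t S k w • ω _ _
        rw [← mul_assoc, ← map_mul, hω, hω, map_mul, mul_smul]
        simp only [mul_inv_rev, weylAction_mul])
    exact LinearMap.congr_fun this h
  · ext1 v
    refine LinearMap.ext fun p => ?_
    have := hω v 1 p
    simp only [map_one, one_mul, one_smul, inv_one, weylAction_one] at this
    exact this

end Restriction

/-- Restriction to polynomials is a bijection commuting with the differentials, so a primitive found
over `S(V)` extends to an equivariant one. -/
lemma exact_koszulD [P.IsReduced] [Finite ι] [FiniteDimensional ℝ V₀]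
    (hk : IsParameterFunction S k) :
    Function.Exact (koszulD S k Y n) (koszulD S k Y (n + 1)) := by
  intro ω
  refine ⟨fun hω => ?_, ?_⟩
  · let b := Module.finBasis ℂ (ℂ ⊗[ℝ] V₀)
    have hd : Koszul.d (coOp S k Y) ω.1 = 0 := congrArg Subtype.val hω
    have hd' : Koszul.d (polyOp S k Y b) ((polyRes S k Y b).compAlternatingMap ω.1) = 0 := by
      rw [← Koszul.d_naturality (polyRes S k Y b) (polyRes_coOp b), hd,
        LinearMap.compAlternatingMap_zero]
    obtain ⟨η', hη'⟩ := Koszul.exists_d_eq (polyOp_comm b) b b.span_eq (fun j g hg => by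
      obtain ⟨f, hf, hfg⟩ := Koszul.exists_coregular
        (fun i => Algebra.lsmul ℂ ℂ Y (HeckeAlgebra.f S k (b i)))
        (fun i j y => by
          simp only [Algebra.lsmul_coe, ← mul_smul]
          rw [HeckeAlgebra.f_mul_comm]) j g (fun i hi p => by
          have := LinearMap.congr_fun (hg i hi) p
          rwa [polyOp_apply, PBW.linForm_basis] at this)
      refine ⟨f, fun i hi => LinearMap.ext fun p => ?_, LinearMap.ext fun p => ?_⟩
      · rw [polyOp_apply, PBW.linForm_basis]; exact hf i hi p
      · rw [polyOp_apply, PBW.linForm_basis]; exact hfg p) _ hd'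
    obtain ⟨η, hη, hηη'⟩ := polyRes_surjective b hk η'
    refine ⟨⟨η, hη⟩, Subtype.ext ?_⟩
    refine polyRes_injective b (d_mem_koszulTerm hη) ω.2 ?_
    change (polyRes S k Y b).compAlternatingMap (Koszul.d (coOp S k Y) η) = _
    rw [Koszul.d_naturality (polyRes S k Y b) (polyRes_coOp b), hηη', hη']
  · rintro ⟨η, rfl⟩
    exact koszulD_koszulD η

end Complex

/-! ### Frobenius reciprocity and injectivity of the terms. -/

/-- The representation of a group on alternating maps between two representations. -/
def altRep {K G V Y : Type*} [CommRing K] [Group G] [AddCommGroup V] [Module K V]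
    [AddCommGroup Y] [Module K Y] (ρ : Representation K G V) (σ : Representation K G Y) (n : ℕ) :
    Representation K G (V [⋀^Fin n]→ₗ[K] Y) where
  toFun g :=
    { toFun := fun ω => (σ g).compAlternatingMap (ω.compLinearMap (ρ g⁻¹))
      map_add' := fun ω ω' => by ext; simp
      map_smul' := fun c ω => by ext; simp }
  map_one' := by ext; simp
  map_mul' g g' := by ext; simp

lemma altRep_apply {K G V Y : Type*} [CommRing K] [Group G] [AddCommGroup V] [Module K V]
    [AddCommGroup Y] [Module K Y] (ρ : Representation K G V) (σ : Representation K G Y) {n : ℕ}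
    (g : G) (ω : V [⋀^Fin n]→ₗ[K] Y) (v : Fin n → V) :
    altRep ρ σ n g ω v = σ g (ω fun i => ρ g⁻¹ (v i)) := rfl

section Coinduction

open RootPairing

variable {ι V₀ N : Type u} [AddCommGroup V₀] [Module ℝ V₀] [AddCommGroup N] [Module ℝ N]
  {P : RootPairing ι ℝ V₀ N} (S : SimpleSystem P) (k : S.support → ℂ)
  (X Y : Type u) [AddCommGroup X] [Module ℂ X] [Module (HeckeAlgebra S k) X]
  [IsScalarTower ℂ (HeckeAlgebra S k) X] [AddCommGroup Y] [Module ℂ Y]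
  [Module (HeckeAlgebra S k) Y] [IsScalarTower ℂ (HeckeAlgebra S k) Y] (n : ℕ)

/-- The space of alternating `n`-forms on `V` with values in `Y`, as a representation of `W`. -/
abbrev formRep : Representation ℂ P.weylGroup ((ℂ ⊗[ℝ] V₀) [⋀^Fin n]→ₗ[ℂ] Y) :=
  altRep (weylRep P) (resW S k Y) n

variable {S k X Y n}

lemma resW_apply (w : P.weylGroup) (x : X) : resW S k X w x = HeckeAlgebra.t S k w • x := rfl

lemma formRep_apply (w : P.weylGroup) (ω : (ℂ ⊗[ℝ] V₀) [⋀^Fin n]→ₗ[ℂ] Y)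
    (v : Fin n → ℂ ⊗[ℝ] V₀) :
    formRep S k Y n w ω v = HeckeAlgebra.t S k w • ω fun i => weylAction P w⁻¹ (v i) := rfl

/-- An `ℍ`-linear map into the coinduced module yields a `W`-equivariant map by evaluation at
`1`. -/
def evalOne (Φ : X →ₗ[HeckeAlgebra S k] koszulTerm S k Y n) :
    (resW S k X).IntertwiningMap (formRep S k Y n) :=
  LinearMap.intertwiningMap_of_isIntertwiningMap _ _
    { toFun := fun x => (CoFun.eval 1).compAlternatingMap (Φ x).1
      map_add' := fun x y => by rw [map_add]; rfl
      map_smul' := fun c x => by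
        ext v
        rw [← algebraMap_smul (HeckeAlgebra S k) c x, map_smul]
        change (Φ x).1 v (1 * algebraMap ℂ _ c) = c • (Φ x).1 v 1
        rw [one_mul, ← map_smul, ← Algebra.algebraMap_eq_smul_one] }
    fun w x => by
      ext v
      rw [formRep_apply, resW_apply]
      simp only [LinearMap.coe_mk, AddHom.coe_mk, LinearMap.compAlternatingMap_apply,
        CoFun.eval_apply, map_smul]
      rw [← koszulTerm_apply (Φ x).2, mul_one]
      exact congrArg ((Φ x).1 v) (one_mul _)

lemma evalOne_apply (Φ : X →ₗ[HeckeAlgebra S k] koszulTerm S k Y n) (x : X)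
    (v : Fin n → ℂ ⊗[ℝ] V₀) : evalOne Φ x v = (Φ x).1 v 1 := rfl

lemma evalOne_smul (Φ : X →ₗ[HeckeAlgebra S k] koszulTerm S k Y n) (x : X)
    (v : Fin n → ℂ ⊗[ℝ] V₀) (h : HeckeAlgebra S k) : evalOne Φ (h • x) v = (Φ x).1 v h := by
  rw [evalOne_apply, map_smul]
  exact congrArg ((Φ x).1 v) (one_mul h)

lemma evalOne_injective : Function.Injective
    (evalOne : (X →ₗ[HeckeAlgebra S k] koszulTerm S k Y n) → _) := by
  intro Φ Ψ h
  ext x v a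
  rw [← evalOne_smul, ← evalOne_smul, h]

/-- The preimage of `ψ` sends `x` to the form `v ↦ (h ↦ ψ (h • x) v)`. -/
lemma evalOne_surjective : Function.Surjective
    (evalOne : (X →ₗ[HeckeAlgebra S k] koszulTerm S k Y n) → _) := by
  intro ψ
  have hψ : ∀ (w : P.weylGroup) x v, ψ (HeckeAlgebra.t S k w • x) v =
      HeckeAlgebra.t S k w • ψ x fun i => weylAction P w⁻¹ (v i) := fun w x v =>
    congrArg (fun η => η v) (LinearMap.congr_fun (ψ.isIntertwining' w) x)
  let θ : X → (ℂ ⊗[ℝ] V₀) [⋀^Fin n]→ₗ[ℂ] CoFun ℂ (HeckeAlgebra S k) Y := fun x =>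
    { toFun := fun v => CoFun.ofLinearMap
        { toFun := fun h => ψ (h • x) v
          map_add' := fun h h' => by rw [add_smul, map_add]; rfl
          map_smul' := fun c h => by rw [smul_assoc, map_smul]; rfl }
      map_update_add' := fun v i a b => by
        ext h; exact (ψ (h • x)).map_update_add v i a b
      map_update_smul' := fun v i c a => by
        ext h; exact (ψ (h • x)).map_update_smul v i c a
      map_eq_zero_of_eq' := fun v i j hv hij => by
        ext h; exact (ψ (h • x)).map_eq_zero_of_eq v hv hij }
  have hθ : ∀ x v h, θ x v h = ψ (h • x) v := fun _ _ _ => rfl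
  refine ⟨{ toFun := fun x => ⟨θ x, fun w v h => ?_⟩, map_add' := fun x y => ?_,
            map_smul' := fun a x => ?_ }, ?_⟩
  · rw [hθ, hθ, mul_smul, hψ]
  · apply Subtype.ext
    ext v h
    change θ (x + y) v h = θ x v h + θ y v h
    rw [hθ, hθ, hθ, smul_add, map_add]; rfl
  · apply Subtype.ext
    ext v h
    change θ (a • x) v h = θ x v (h * a)
    rw [hθ, hθ, mul_smul]
  · ext x v
    change θ x v 1 = _
    rw [hθ, one_smul]
    rfl

/-- The terms of the Koszul coresolution are injective. -/
lemma injective_koszulTerm [Finite ι] : Module.Injective (HeckeAlgebra S k) (koszulTerm S k Y n) := by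
  refine ⟨fun A B _ _ _ _ f hf g => ?_⟩
  let _ : Module ℂ A := Module.restrictScalars ℂ (HeckeAlgebra S k) A
  have _ : IsScalarTower ℂ (HeckeAlgebra S k) A := IsScalarTower.restrictScalars _ _ _
  let _ : Module ℂ B := Module.restrictScalars ℂ (HeckeAlgebra S k) B
  have _ : IsScalarTower ℂ (HeckeAlgebra S k) B := IsScalarTower.restrictScalars _ _ _
  let ψ := evalOne g
  let f' : A →ₗ[ℂ] B := f.restrictScalars ℂ
  obtain ⟨r, hr⟩ := f'.exists_leftInverse_of_injective (LinearMap.ker_eq_bot.mpr hf)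
  let σ := formRep S k Y n
  let T : HeckeAlgebra S k →ₐ[ℂ] Module.End ℂ B := Algebra.lsmul ℂ ℂ B
  -- By reciprocity only a `W`-map has to be extended, so Maschke's averaging of the `ℂ`-linear
  -- extension `ψ ∘ r` suffices.
  let χ : B →ₗ[ℂ] ((ℂ ⊗[ℝ] V₀) [⋀^Fin n]→ₗ[ℂ] Y) := (Fintype.card P.weylGroup : ℂ)⁻¹ •
    ∑ w, σ w ∘ₗ (ψ.toLinearMap ∘ₗ r) ∘ₗ resW S k B w⁻¹
  have hχ : ∀ x, χ x = (Fintype.card P.weylGroup : ℂ)⁻¹ •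
      ∑ w, σ w (ψ (r (resW S k B w⁻¹ x))) := fun x => by
    simp only [χ, LinearMap.smul_apply, LinearMap.sum_apply]; rfl
  let χ' : (resW S k B).IntertwiningMap (formRep S k Y n) :=
    LinearMap.intertwiningMap_of_isIntertwiningMap _ _ χ fun u x => by
      rw [hχ, hχ, map_smul, map_sum]
      congr 1
      rw [← Equiv.sum_comp (Equiv.mulLeft u)]
      refine Finset.sum_congr rfl fun w _ => ?_
      rw [Equiv.coe_mulLeft, map_mul, Module.End.mul_apply, mul_inv_rev, map_mul,
        Module.End.mul_apply, ← Module.End.mul_apply (resW S k B u⁻¹), ← map_mul, inv_mul_cancel,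
        map_one, Module.End.one_apply]
  obtain ⟨Φ, hΦ⟩ := evalOne_surjective χ'
  refine ⟨Φ, fun a => ?_⟩
  have : Φ ∘ₗ f = g := by
    apply evalOne_injective
    ext1
    refine LinearMap.ext fun a => ?_
    have h1 : evalOne (Φ ∘ₗ f) a = χ (f a) := by
      change evalOne Φ (f a) = _
      rw [hΦ]; rfl
    change evalOne (Φ ∘ₗ f) a = ψ a
    rw [h1, hχ]
    have h2 : ∀ w : P.weylGroup, σ w (ψ (r (resW S k B w⁻¹ (f a)))) = ψ a := by
      intro w
      have h3 : resW S k B w⁻¹ (f a) = f' (resW S k A w⁻¹ a) := (f.map_smul _ a).symm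
      have h4 : r (f' (resW S k A w⁻¹ a)) = resW S k A w⁻¹ a := LinearMap.congr_fun hr _
      have h5 : ψ (resW S k A w⁻¹ a) = σ w⁻¹ (ψ a) :=
        LinearMap.congr_fun (ψ.isIntertwining' w⁻¹) a
      rw [h3, h4, h5, ← Module.End.mul_apply, ← map_mul, mul_inv_cancel, map_one,
        Module.End.one_apply]
    rw [Finset.sum_congr rfl fun w _ => h2 w, Finset.sum_const, Finset.card_univ,
      ← Nat.cast_smul_eq_nsmul ℂ, smul_smul, inv_mul_cancel₀, one_smul]
    exact Nat.cast_ne_zero.mpr Fintype.card_ne_zero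
  exact LinearMap.congr_fun this a

end Coinduction

/-! ### Dimension counts in long exact sequences. -/

section LongExact

variable {K : Type*} [Field K] {A B C : ℕ → Type*} [∀ i, AddCommGroup (A i)]
  [∀ i, Module K (A i)] [∀ i, AddCommGroup (B i)] [∀ i, Module K (B i)] [∀ i, AddCommGroup (C i)]
  [∀ i, Module K (C i)] {f : ∀ i, A i →ₗ[K] B i} {g : ∀ i, B i →ₗ[K] C i}
  {δ : ∀ i, C i →ₗ[K] A (i + 1)}

lemma finite_of_longExact (h0 : Function.Injective (f 0))
    (hA : ∀ i, Function.Exact (δ i) (f (i + 1)))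
    [∀ i, FiniteDimensional K (B i)] [∀ i, FiniteDimensional K (C i)] (i : ℕ) :
    FiniteDimensional K (A i) := by
  cases i with
  | zero => exact FiniteDimensional.of_injective (f 0) h0
  | succ i =>
    have h1 : FiniteDimensional K (LinearMap.ker (f (i + 1))) := by
      rw [LinearMap.exact_iff.mp (hA i)]; infer_instance
    have h2 : FiniteDimensional K (A (i + 1) ⧸ LinearMap.ker (f (i + 1))) :=
      (f (i + 1)).quotKerEquivRange.symm.finiteDimensional
    exact Module.Finite.of_submodule_quotient (LinearMap.ker (f (i + 1)))

/-- Rank–nullity at each spot makes the ranks telescope; truncating at `n` leaves only the rank of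
the last connecting map. -/
lemma sum_finrank_of_longExact (h0 : Function.Injective (f 0))
    (hA : ∀ i, Function.Exact (δ i) (f (i + 1))) (hB : ∀ i, Function.Exact (f i) (g i))
    (hC : ∀ i, Function.Exact (g i) (δ i))
    [∀ i, FiniteDimensional K (B i)] [∀ i, FiniteDimensional K (C i)] (n : ℕ) :
    ∑ i ∈ Finset.range (n + 1), (-1 : ℤ) ^ i * (Module.finrank K (A i) : ℤ) =
      ∑ i ∈ Finset.range (n + 1), (-1 : ℤ) ^ i * (Module.finrank K (B i) : ℤ) -
      ∑ i ∈ Finset.range (n + 1), (-1 : ℤ) ^ i * (Module.finrank K (C i) : ℤ) +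
      (-1) ^ n * (Module.finrank K (LinearMap.range (δ n)) : ℤ) := by
  have hfin : ∀ i, FiniteDimensional K (A i) := finite_of_longExact h0 hA
  have eB : ∀ i, (Module.finrank K (B i) : ℤ) = Module.finrank K (LinearMap.range (f i)) +
      Module.finrank K (LinearMap.range (g i)) := by
    intro i
    rw [← LinearMap.exact_iff.mp (hB i), ← (g i).finrank_range_add_finrank_ker]
    push_cast; ring
  have eC : ∀ i, (Module.finrank K (C i) : ℤ) = Module.finrank K (LinearMap.range (g i)) +
      Module.finrank K (LinearMap.range (δ i)) := by
    intro i
    rw [← LinearMap.exact_iff.mp (hC i), ← (δ i).finrank_range_add_finrank_ker]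
    push_cast; ring
  have eA : ∀ i, (Module.finrank K (A (i + 1)) : ℤ) =
      Module.finrank K (LinearMap.range (f (i + 1))) +
      Module.finrank K (LinearMap.range (δ i)) := by
    intro i
    rw [← LinearMap.exact_iff.mp (hA i), ← (f (i + 1)).finrank_range_add_finrank_ker]
    push_cast; ring
  have eA0 : Module.finrank K (A 0) = Module.finrank K (LinearMap.range (f 0)) :=
    (LinearMap.finrank_range_of_inj h0).symm
  induction n with
  | zero =>
    simp only [zero_add, Finset.range_one, Finset.sum_singleton, pow_zero, one_mul]
    rw [eB, eC, eA0]; ring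
  | succ n ih =>
    rw [Finset.sum_range_succ, ih, Finset.sum_range_succ _ (n + 1), Finset.sum_range_succ _ (n + 1),
      eA, eB (n + 1), eC (n + 1), pow_succ]
    ring

end LongExact

/-! ### Euler characteristics of `Ext` from injective coresolutions. -/

section EulerCharacteristic

open CategoryTheory CategoryTheory.Abelian

variable (K : Type*) {H : Type u} [Field K] [Ring H] [Algebra K H]

/-- The groups `Ext^i(X, A)` are finite-dimensional, vanish for large `i`, and have Euler
characteristic `e`. -/
def HasEulerChar (X A : ModuleCat.{u} H) (e : ℤ) : Prop :=
  (∀ i, FiniteDimensional K (Ext X A i)) ∧ ∃ n, (∀ i ≥ n, Subsingleton (Ext X A i)) ∧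
    ∑ i ∈ Finset.range n, (-1 : ℤ) ^ i * (Module.finrank K (Ext X A i) : ℤ) = e

variable {K}

lemma HasEulerChar.sum_range_eq {X A : ModuleCat.{u} H} {e : ℤ} {n : ℕ}
    (hn : ∀ i ≥ n, Subsingleton (Ext X A i))
    (he : ∑ i ∈ Finset.range n, (-1 : ℤ) ^ i * (Module.finrank K (Ext X A i) : ℤ) = e)
    {m : ℕ} (hm : n ≤ m) :
    ∑ i ∈ Finset.range m, (-1 : ℤ) ^ i * (Module.finrank K (Ext X A i) : ℤ) = e := by
  rw [← he]
  refine (Finset.sum_subset (Finset.range_mono hm) fun i _ hi => ?_).symm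
  have := hn i (not_lt.mp fun h => hi (Finset.mem_range.mpr h))
  rw [Module.finrank_zero_of_subsingleton, Nat.cast_zero, mul_zero]

lemma HasEulerChar.of_shortExact {X : ModuleCat.{u} H} {S : ShortComplex (ModuleCat.{u} H)}
    (hS : S.ShortExact) {b c : ℤ} (hB : HasEulerChar K X S.X₂ b) (hC : HasEulerChar K X S.X₃ c) :
    HasEulerChar K X S.X₁ (b - c) := by
  let f : ∀ i, Ext X S.X₁ i →ₗ[K] Ext X S.X₂ i := fun i =>
    (Ext.mk₀ S.f).postcompOfLinear K X (add_zero i)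
  let g : ∀ i, Ext X S.X₂ i →ₗ[K] Ext X S.X₃ i := fun i =>
    (Ext.mk₀ S.g).postcompOfLinear K X (add_zero i)
  let δ : ∀ i, Ext X S.X₃ i →ₗ[K] Ext X S.X₁ (i + 1) := fun i =>
    hS.extClass.postcompOfLinear K X rfl
  have h0 : Function.Injective (f 0) := by
    have := hS.mono_f
    exact Ext.postcomp_mk₀_injective_of_mono X S.f
  have eA : ∀ i, Function.Exact (δ i) (f (i + 1)) := fun i x =>
    ⟨fun hx => Ext.covariant_sequence_exact₁ X hS x hx rfl, by
      rintro ⟨y, rfl⟩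
      change (y.comp hS.extClass rfl).comp (Ext.mk₀ S.f) (add_zero (i + 1)) = 0
      rw [Ext.comp_assoc_of_third_deg_zero, hS.extClass_comp, Ext.comp_zero]⟩
  have eB : ∀ i, Function.Exact (f i) (g i) := fun i x =>
    ⟨fun hx => Ext.covariant_sequence_exact₂ X hS x hx, by
      rintro ⟨y, rfl⟩
      change (y.comp (Ext.mk₀ S.f) (add_zero i)).comp (Ext.mk₀ S.g) (add_zero i) = 0
      rw [Ext.comp_assoc_of_third_deg_zero, Ext.mk₀_comp_mk₀, S.zero, Ext.mk₀_zero,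
        Ext.comp_zero]⟩
  have eC : ∀ i, Function.Exact (g i) (δ i) := fun i x =>
    ⟨fun hx => Ext.covariant_sequence_exact₃ X hS x rfl hx, by
      rintro ⟨y, rfl⟩
      change (y.comp (Ext.mk₀ S.g) (add_zero i)).comp hS.extClass rfl = 0
      rw [Ext.comp_assoc_of_second_deg_zero, hS.comp_extClass, Ext.comp_zero]⟩
  obtain ⟨hBf, n, hn, hBe⟩ := hB
  obtain ⟨hCf, m, hm, hCe⟩ := hC
  refine ⟨finite_of_longExact h0 eA, max n m + 1, fun i hi => ?_, ?_⟩
  · obtain ⟨j, rfl⟩ : ∃ j, i = j + 1 := ⟨i - 1, by omega⟩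
    have h1 : Subsingleton (Ext X S.X₂ (j + 1)) := hn _ (by omega)
    have h2 : Subsingleton (Ext X S.X₃ j) := hm _ (by omega)
    refine subsingleton_of_forall_eq 0 fun x => ?_
    obtain ⟨y, rfl⟩ := (eA j x).mp (Subsingleton.elim _ _)
    rw [Subsingleton.elim y 0, map_zero]
  · have h2 : Subsingleton (Ext X S.X₃ (max n m)) := hm _ (le_max_right _ _)
    have h3 : LinearMap.range (δ (max n m)) = ⊥ := by
      rw [LinearMap.range_eq_bot]
      ext x
      rw [Subsingleton.elim x 0, map_zero, map_zero]
    rw [sum_finrank_of_longExact h0 eA eB eC, h3, finrank_bot, Nat.cast_zero, mul_zero, add_zero,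
      HasEulerChar.sum_range_eq hn hBe (by omega), HasEulerChar.sum_range_eq hm hCe (by omega)]

lemma HasEulerChar.of_injective {X A : ModuleCat.{u} H} [Injective A]
    [FiniteDimensional K (X ⟶ A)] : HasEulerChar K X A (Module.finrank K (X ⟶ A)) := by
  have hs : ∀ i ≥ 1, Subsingleton (Ext X A i) := by
    intro i hi
    obtain ⟨j, rfl⟩ : ∃ j, i = j + 1 := ⟨i - 1, by omega⟩
    exact Ext.subsingleton_of_injective X A j
  have e : Ext X A 0 ≃ₗ[K] (X ⟶ A) := Ext.linearEquiv₀
  refine ⟨fun i => ?_, 1, hs, ?_⟩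
  · cases i with
    | zero => exact e.symm.finiteDimensional
    | succ i => have := hs (i + 1) (by omega); infer_instance
  · rw [Finset.sum_range_one, pow_zero, one_mul, e.finrank_eq]

lemma HasEulerChar.of_isZero {X A : ModuleCat.{u} H} (hA : Limits.IsZero A) :
    HasEulerChar K X A 0 := by
  have hs : ∀ i, Subsingleton (Ext X A i) := fun i => by
    refine subsingleton_of_forall_eq 0 fun x => ?_
    rw [← Ext.comp_mk₀_id x, hA.eq_of_src (𝟙 A) 0, Ext.mk₀_zero, Ext.comp_zero]
  exact ⟨fun i => inferInstance, 0, fun i _ => hs i, rfl⟩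

lemma HasEulerChar.of_exact {X A B C : Type u} [AddCommGroup X] [Module H X] [AddCommGroup A]
    [Module H A] [AddCommGroup B] [Module H B] [AddCommGroup C] [Module H C]
    {f : A →ₗ[H] B} {g : B →ₗ[H] C} (hf : Function.Injective f) (hfg : Function.Exact f g)
    (hg : Function.Surjective g) {b c : ℤ}
    (hB : HasEulerChar K (ModuleCat.of H X) (ModuleCat.of H B) b)
    (hC : HasEulerChar K (ModuleCat.of H X) (ModuleCat.of H C) c) :
    HasEulerChar K (ModuleCat.of H X) (ModuleCat.of H A) (b - c) := by
  let S : ShortComplex (ModuleCat.{u} H) := ShortComplex.mk (ModuleCat.ofHom f) (ModuleCat.ofHom g)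
    (by ext x; exact hfg.apply_apply_eq_zero x)
  have hS : S.ShortExact :=
    { exact := (ShortComplex.ShortExact.moduleCat_exact_iff_function_exact S).mpr hfg
      mono_f := (ModuleCat.mono_iff_injective _).mpr hf
      epi_g := (ModuleCat.epi_iff_surjective _).mpr hg }
  exact HasEulerChar.of_shortExact (S := S) hS hB hC

/-- The Euler characteristic computed from a finite injective coresolution. -/
theorem HasEulerChar.of_coresolution {X Y : Type u} [AddCommGroup X] [Module H X]
    [AddCommGroup Y] [Module H Y] {C : ℕ → Type u} [∀ n, AddCommGroup (C n)] [∀ n, Module H (C n)]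
    {ε : Y →ₗ[H] C 0} {d : ∀ n, C n →ₗ[H] C (n + 1)} (hε : Function.Injective ε)
    (hεd : Function.Exact ε (d 0)) (hd : ∀ n, Function.Exact (d n) (d (n + 1)))
    (hinj : ∀ n, Module.Injective H (C n))
    [∀ n, FiniteDimensional K (ModuleCat.of H X ⟶ ModuleCat.of H (C n))]
    {D : ℕ} (hD : ∀ n ≥ D, Subsingleton (C n)) :
    HasEulerChar K (ModuleCat.of H X) (ModuleCat.of H Y) (∑ n ∈ Finset.range (D + 1),
      (-1 : ℤ) ^ n * (Module.finrank K (ModuleCat.of H X ⟶ ModuleCat.of H (C n)) : ℤ)) := by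
  let u : ℕ → ℤ := fun n => Module.finrank K (ModuleCat.of H X ⟶ ModuleCat.of H (C n))
  have hC : ∀ n, HasEulerChar K (ModuleCat.of H X) (ModuleCat.of H (C n)) (u n) := fun n => by
    have := Module.injective_object_of_injective_module (R := H) (M := C n)
    exact HasEulerChar.of_injective
  have hsum : ∀ n j, u n - ∑ l ∈ Finset.range j, (-1 : ℤ) ^ l * u (n + 1 + l) =
      ∑ l ∈ Finset.range (j + 1), (-1 : ℤ) ^ l * u (n + l) := by
    intro n j
    rw [Finset.sum_range_succ', pow_zero, one_mul, add_zero, sub_eq_neg_add,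
      ← Finset.sum_neg_distrib]
    congr 1
    refine Finset.sum_congr rfl fun l _ => ?_
    rw [pow_succ, add_right_comm, add_assoc n l 1]; ring
  -- Dimension shifting along `0 → A → C n → ker (d (n + 1)) → 0`. It serves both the kernels and,
  -- at `n = 0`, the augmentation.
  have step : ∀ (n j : ℕ) {A : Type u} [AddCommGroup A] [Module H A] (f : A →ₗ[H] C n),
      Function.Injective f → Function.Exact f (d n) →
      HasEulerChar K (ModuleCat.of H X) (ModuleCat.of H (LinearMap.ker (d (n + 1))))
        (∑ l ∈ Finset.range j, (-1 : ℤ) ^ l * u (n + 1 + l)) →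
      HasEulerChar K (ModuleCat.of H X) (ModuleCat.of H A)
        (∑ l ∈ Finset.range (j + 1), (-1 : ℤ) ^ l * u (n + l)) := by
    intro n j A _ _ f hf hfd hZ
    rw [← hsum]
    let g : C n →ₗ[H] LinearMap.ker (d (n + 1)) :=
      (d n).codRestrict _ fun x => (hd n).apply_apply_eq_zero x
    refine HasEulerChar.of_exact (f := f) (g := g) hf ?_ ?_ (hC n) hZ
    · intro x
      rw [← hfd x]
      exact ⟨fun h => congrArg Subtype.val h, fun h => Subtype.ext h⟩
    · rintro ⟨z, hz⟩
      obtain ⟨x, hx⟩ := (hd n z).mp hz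
      exact ⟨x, Subtype.ext hx⟩
  -- Descending induction on `n`, starting at `n = D + 1`, where `C n = 0`.
  have hker : ∀ j n, n + j = D + 1 →
      HasEulerChar K (ModuleCat.of H X) (ModuleCat.of H (LinearMap.ker (d n)))
        (∑ l ∈ Finset.range j, (-1 : ℤ) ^ l * u (n + l)) := by
    intro j
    induction j with
    | zero =>
      intro n hn
      have := hD n (by omega)
      exact HasEulerChar.of_isZero (ModuleCat.isZero_of_subsingleton _)
    | succ j ih =>
      intro n hn
      refine step n j (LinearMap.ker (d n)).subtype Subtype.val_injective ?_ (ih _ (by omega))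
      intro x
      rw [Submodule.coe_subtype, Subtype.range_coe]
      rfl
  have := step 0 D ε hε hεd (hker D 1 (by omega))
  simpa only [zero_add] using this

end EulerCharacteristic

/-! ### Traces and determinants of operators of finite order. -/

section Eigenbasis

variable {V : Type*} [AddCommGroup V] [Module ℂ V]

lemma trace_eq_sum_of_eigenbasis {ι : Type*} [Fintype ι] {g : Module.End ℂ V}
    (b : Module.Basis ι ℂ V) {c : ι → ℂ} (h : ∀ i, g (b i) = c i • b i) :
    LinearMap.trace ℂ V g = ∑ i, c i := by
  classical
  rw [LinearMap.trace_eq_matrix_trace ℂ b, Matrix.trace]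
  refine Finset.sum_congr rfl fun i _ => ?_
  simp [LinearMap.toMatrix_apply, h]

lemma det_one_sub_of_eigenbasis {ι : Type*} [Fintype ι] {g : Module.End ℂ V}
    (b : Module.Basis ι ℂ V) {c : ι → ℂ} (h : ∀ i, g (b i) = c i • b i) :
    LinearMap.det (1 - g) = ∏ i, (1 - c i) := by
  classical
  rw [← LinearMap.det_toMatrix b]
  have : LinearMap.toMatrix b b (1 - g) = Matrix.diagonal fun i => 1 - c i := by
    ext i j
    rw [LinearMap.toMatrix_apply, LinearMap.sub_apply, h, Module.End.one_apply, ← one_smul ℂ (b j),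
      smul_smul, ← sub_smul, mul_one, map_smul, Module.Basis.repr_self, Matrix.diagonal_apply]
    by_cases hij : i = j
    · subst hij; simp
    · simp [hij]
  rw [this, Matrix.det_diagonal]

variable [FiniteDimensional ℂ V]

/-- An operator of finite order on a complex vector space has a basis of eigenvectors. -/
lemma exists_eigenbasis {g : Module.End ℂ V} {m : ℕ} (hm : 0 < m) (hg : g ^ m = 1) :
    ∃ (b : Module.Basis (Fin (Module.finrank ℂ V)) ℂ V) (c : Fin (Module.finrank ℂ V) → ℂ),
      ∀ i, g (b i) = c i • b i := by
  -- The operator is annihilated by the separable polynomial `X ^ m - 1`.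
  have hss : g.IsSemisimple := by
    refine Module.End.isSemisimple_of_squarefree_aeval_eq_zero
      (p := Polynomial.X ^ m - Polynomial.C 1) ?_ (by simp [hg])
    exact (Polynomial.separable_X_pow_sub_C 1 (by exact_mod_cast hm.ne') one_ne_zero).squarefree
  let s : Set V := {v | ∃ μ : ℂ, g v = μ • v}
  have hs : ⊤ ≤ Submodule.span ℂ s := by
    rw [← hss.iSup_eigenspace_eq_top]
    refine iSup_le fun μ v hv => Submodule.subset_span ⟨μ, ?_⟩
    exact Module.End.mem_eigenspace_iff.mp hv
  let b₀ := Module.Basis.ofSpan hs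
  have hb₀ : ∀ i, b₀ i ∈ s := fun i => Module.Basis.ofSpan_subset hs ⟨i, rfl⟩
  have hfin := Module.Finite.finite_basis b₀
  have := Fintype.ofFinite ((linearIndepOn_empty ℂ (id : V → V)).extend (Set.empty_subset s))
  let e := Fintype.equivFinOfCardEq (Module.finrank_eq_card_basis b₀).symm
  let b := b₀.reindex e
  have hb : ∀ i, b i ∈ s := fun i => by
    rw [Module.Basis.reindex_apply]; exact hb₀ _
  exact ⟨b, fun i => (hb i).choose, fun i => (hb i).choose_spec⟩

/-- The character of a finite group at an inverse is the complex conjugate. -/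
lemma character_inv {G : Type*} [Group G] [Finite G] (ρ : Representation ℂ G V) (g : G) :
    ρ.character g⁻¹ = conj (ρ.character g) := by
  have := Fintype.ofFinite G
  have hpos : 0 < Fintype.card G := Fintype.card_pos
  have hg : ρ g ^ Fintype.card G = 1 := by rw [← map_pow, pow_card_eq_one, map_one]
  obtain ⟨b, c, h⟩ := exists_eigenbasis hpos hg
  -- The eigenvalues are roots of unity, so their inverses are their conjugates.
  have hc : ∀ i, c i ^ Fintype.card G = 1 := by
    intro i
    have h1 : ∀ n : ℕ, (ρ g ^ n) (b i) = c i ^ n • b i := by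
      intro n
      induction n with
      | zero => simp
      | succ n ih => rw [pow_succ, Module.End.mul_apply, h, map_smul, ih, smul_smul, pow_succ']
    have h2 := h1 (Fintype.card G)
    rw [hg, Module.End.one_apply] at h2
    have h3 : (c i ^ Fintype.card G - 1) • b i = 0 := by rw [sub_smul, ← h2, one_smul, sub_self]
    exact sub_eq_zero.mp ((smul_eq_zero.mp h3).resolve_right (b.ne_zero i))
  have hne : ∀ i, c i ≠ 0 := fun i h0 => by
    have := hc i
    rw [h0, zero_pow hpos.ne'] at this
    exact zero_ne_one this
  have hinv : ∀ i, ρ g⁻¹ (b i) = (conj (c i)) • b i := by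
    intro i
    rw [← Complex.inv_eq_conj (Complex.norm_eq_one_of_pow_eq_one (hc i) hpos.ne')]
    have h1 : ρ g⁻¹ (ρ g (b i)) = b i := by
      rw [← Module.End.mul_apply, ← map_mul, inv_mul_cancel, map_one, Module.End.one_apply]
    rw [h, map_smul] at h1
    rw [← h1, smul_smul, inv_mul_cancel₀ (hne i), one_smul, h1]
  rw [Representation.character, Representation.character, trace_eq_sum_of_eigenbasis b h,
    trace_eq_sum_of_eigenbasis b hinv, map_sum]

end Eigenbasis

/-! ### Characters of spaces of alternating forms. -/

section Forms

variable {V Y : Type*} [AddCommGroup V] [Module ℂ V] [AddCommGroup Y] [Module ℂ Y] {n : ℕ}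

/-- An alternating map is determined by its values on ordered tuples of basis vectors. -/
def formEquiv {I : Type*} [LinearOrder I] (b : Module.Basis I ℂ V) (n : ℕ) :
    (V [⋀^Fin n]→ₗ[ℂ] Y) ≃ₗ[ℂ] (Set.powersetCard I n → Y) :=
  exteriorPower.alternatingMapLinearEquiv ≪≫ₗ ((b.exteriorPower n).constr ℂ).symm

lemma formEquiv_apply {I : Type*} [LinearOrder I] (b : Module.Basis I ℂ V)
    (ω : V [⋀^Fin n]→ₗ[ℂ] Y) (s : Set.powersetCard I n) :
    formEquiv b n ω s = ω (b ∘ Set.powersetCard.ofFinEmbEquiv.symm s) := by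
  simp [formEquiv, Module.Basis.constr, exteriorPower.ιMulti_family]

variable [FiniteDimensional ℂ Y]

lemma trace_pi_smul {J : Type*} [Fintype J] (c : J → ℂ) (B : Module.End ℂ Y)
    (T : Module.End ℂ (J → Y)) (hT : ∀ φ j, T φ j = c j • B (φ j)) :
    LinearMap.trace ℂ (J → Y) T = (∑ j, c j) * LinearMap.trace ℂ Y B := by
  classical
  let e := Module.finBasis ℂ Y
  let E := Pi.basis fun _ : J => e
  rw [LinearMap.trace_eq_matrix_trace ℂ E, LinearMap.trace_eq_matrix_trace ℂ e, Matrix.trace,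
    Matrix.trace, Fintype.sum_sigma, Finset.sum_mul]
  refine Finset.sum_congr rfl fun j _ => ?_
  rw [Finset.mul_sum]
  refine Finset.sum_congr rfl fun l _ => ?_
  simp [LinearMap.toMatrix_apply, E, hT]

/-- In the coordinates `formEquiv` for an eigenbasis, `T` acts on the component of an `n`-subset `s`
as `B` times the product of the eigenvalues over `s`; the sum over `s` is an elementary symmetric
function. -/
lemma trace_form {I : Type*} [LinearOrder I] [Fintype I] (b : Module.Basis I ℂ V)
    {g : Module.End ℂ V} {c : I → ℂ} (h : ∀ i, g (b i) = c i • b i) (B : Module.End ℂ Y)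
    (T : Module.End ℂ (V [⋀^Fin n]→ₗ[ℂ] Y)) (hT : ∀ ω v, T ω v = B (ω fun i => g (v i))) :
    LinearMap.trace ℂ _ T =
      (∑ s ∈ Finset.univ.powersetCard n, ∏ i ∈ s, c i) * LinearMap.trace ℂ Y B := by
  classical
  rw [← LinearMap.trace_conj' T (formEquiv b n),
    trace_pi_smul (fun s : Set.powersetCard I n => ∏ i ∈ s.1, c i) B]
  · congr 1
    have hs : ∀ s, s ∈ Finset.univ.powersetCard n ↔ s ∈ Set.powersetCard I n := fun s => by
      simp [Finset.mem_powersetCard]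
    exact (Finset.sum_subtype _ hs fun s => ∏ i ∈ s, c i).symm
  · intro φ s
    obtain ⟨ω, rfl⟩ := (formEquiv b n).surjective φ
    rw [LinearEquiv.conj_apply_apply, LinearEquiv.symm_apply_apply, formEquiv_apply,
      formEquiv_apply, hT]
    simp only [Function.comp_apply, h]
    rw [ω.map_smul_univ, map_smul]
    congr 1
    have : s.1 = Finset.univ.map (Set.powersetCard.ofFinEmbEquiv.symm s).toEmbedding := by
      ext i
      simp only [Finset.mem_map, Finset.mem_univ, true_and]
      exact (Set.powersetCard.mem_range_ofFinEmbEquiv_symm_iff_mem s i).symm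
    rw [this, Finset.prod_map]
    rfl

variable [FiniteDimensional ℂ V]

instance finiteDimensional_alternatingMap : FiniteDimensional ℂ (V [⋀^Fin n]→ₗ[ℂ] Y) :=
  (formEquiv (Module.finBasis ℂ V) n).symm.finiteDimensional

lemma subsingleton_alternatingMap {Z : Type*} [AddCommGroup Z] [Module ℂ Z]
    (hn : Module.finrank ℂ V < n) : Subsingleton (V [⋀^Fin n]→ₗ[ℂ] Z) := by
  refine subsingleton_of_forall_eq 0 fun ω => ?_
  ext v
  refine ω.map_linearDependent v fun h => ?_
  have := h.fintype_card_le_finrank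
  rw [Fintype.card_fin] at this
  omega

/-- The alternating sum of the characters of the spaces of alternating forms. -/
lemma sum_character_altRep {G : Type*} [Group G] [Finite G] (ρ : Representation ℂ G V)
    (σ : Representation ℂ G Y) (g : G) :
    ∑ n ∈ Finset.range (Module.finrank ℂ V + 1), (-1) ^ n * (altRep ρ σ n).character g =
      σ.character g * LinearMap.det (1 - ρ g⁻¹) := by
  have := Fintype.ofFinite G
  have hg : ρ g⁻¹ ^ Fintype.card G = 1 := by rw [← map_pow, pow_card_eq_one, map_one]
  obtain ⟨b, c, h⟩ := exists_eigenbasis Fintype.card_pos hg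
  have htr : ∀ n, (altRep ρ σ n).character g =
      (∑ s ∈ Finset.univ.powersetCard n, ∏ i ∈ s, c i) * σ.character g := fun n =>
    trace_form b h (σ g) _ fun ω v => altRep_apply ρ σ g ω v
  simp only [htr]
  rw [det_one_sub_of_eigenbasis b h, mul_comm (σ.character g)]
  simp only [← mul_assoc]
  rw [← Finset.sum_mul]
  congr 1
  -- The product `∏ (1 - c_i)` is expanded over subsets, which are then grouped by cardinality.
  simp only [sub_eq_add_neg, Finset.prod_one_add]
  rw [Finset.sum_powerset, Finset.card_univ, Fintype.card_fin]
  refine Finset.sum_congr rfl fun n _ => ?_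
  rw [Finset.mul_sum]
  refine Finset.sum_congr rfl fun s hs => ?_
  rw [Finset.prod_neg, (Finset.mem_powersetCard.mp hs).2]

end Forms

/-! ### The Euler–Poincaré pairing. -/

section EulerPoincare

open CategoryTheory

variable {ι V₀ N : Type u} [AddCommGroup V₀] [Module ℝ V₀] [AddCommGroup N] [Module ℝ N]
  {P : RootPairing ι ℝ V₀ N} (S : SimpleSystem P) (k : S.support → ℂ)
  (X Y : Type u) [AddCommGroup X] [Module ℂ X] [Module (HeckeAlgebra S k) X]
  [IsScalarTower ℂ (HeckeAlgebra S k) X] [AddCommGroup Y] [Module ℂ Y]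
  [Module (HeckeAlgebra S k) Y] (n : ℕ)

lemma subsingleton_koszulTerm [FiniteDimensional ℝ V₀]
    (hn : Module.finrank ℂ (ℂ ⊗[ℝ] V₀) < n) :
    Subsingleton (koszulTerm S k Y n) :=
  have := subsingleton_alternatingMap (Z := CoFun ℂ (HeckeAlgebra S k) Y) hn
  inferInstanceAs (Subsingleton (Subtype _))

variable [IsScalarTower ℂ (HeckeAlgebra S k) Y]

/-- Homomorphisms into a term of the Koszul coresolution are `W`-equivariant maps. -/
def homEquiv : (ModuleCat.of (HeckeAlgebra S k) X ⟶
      ModuleCat.of (HeckeAlgebra S k) (koszulTerm S k Y n)) ≃ₗ[ℂ]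
    (resW S k X).IntertwiningMap (formRep S k Y n) :=
  LinearEquiv.ofBijective
    { toFun := fun f => evalOne f.hom
      map_add' := fun f g => by
        ext x v
        rfl
      map_smul' := fun c f => by
        ext x v
        change (f.hom x).1 v (1 * algebraMap ℂ (HeckeAlgebra S k) c) = c • (f.hom x).1 v 1
        rw [one_mul, Algebra.algebraMap_eq_smul_one, map_smul] }
    ⟨fun f g h => ModuleCat.hom_ext (evalOne_injective h), fun ψ => by
      obtain ⟨Φ, hΦ⟩ := evalOne_surjective ψ
      exact ⟨ModuleCat.ofHom Φ, hΦ⟩⟩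

variable [Finite ι] [FiniteDimensional ℝ V₀] [FiniteDimensional ℂ X]
  [FiniteDimensional ℂ Y]

instance finiteDimensional_formRep_intertwiningMap :
    FiniteDimensional ℂ ((resW S k X).IntertwiningMap (formRep S k Y n)) :=
  Module.Finite.equiv
    (Representation.invariantsEquivIntertwiningMap (resW S k X) (formRep S k Y n))

instance finiteDimensional_hom_koszulTerm : FiniteDimensional ℂ (ModuleCat.of (HeckeAlgebra S k) X ⟶
      ModuleCat.of (HeckeAlgebra S k) (koszulTerm S k Y n)) :=
  (homEquiv S k X Y n).symm.finiteDimensional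

lemma finrank_hom_koszulTerm : (Module.finrank ℂ (ModuleCat.of (HeckeAlgebra S k) X ⟶
      ModuleCat.of (HeckeAlgebra S k) (koszulTerm S k Y n)) : ℂ) =
    (Fintype.card P.weylGroup : ℂ)⁻¹ *
      ∑ w : P.weylGroup, (formRep S k Y n).character w * (resW S k X).character w⁻¹ := by
  have h0 : (Nat.card P.weylGroup : ℂ) ≠ 0 := Nat.cast_ne_zero.mpr Nat.card_pos.ne'
  have := invertibleOfNonzero h0
  rw [(homEquiv S k X Y n).finrank_eq,
    ← Representation.card_inv_mul_sum_char_mul_char_eq_finrank, Nat.card_eq_fintype_card]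

/-- Summing over `n` first yields `det (1 - w⁻¹)`. Reindexing by `w ↦ w⁻¹` turns this into `det (1 -
w)` and moves the inverse from `tr_X` to `tr_Y`, where `character_inv` makes it a conjugate. -/
lemma sum_finrank_hom_koszulTerm :
    ∑ n ∈ Finset.range (Module.finrank ℂ (ℂ ⊗[ℝ] V₀) + 1), (-1 : ℂ) ^ n *
      (Module.finrank ℂ (ModuleCat.of (HeckeAlgebra S k) X ⟶
        ModuleCat.of (HeckeAlgebra S k) (koszulTerm S k Y n)) : ℂ) =
    ellipticPairing (resW S k X) (resW S k Y) := by
  simp only [finrank_hom_koszulTerm, Finset.mul_sum, ellipticPairing]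
  rw [Finset.sum_comm, ← Equiv.sum_comp (Equiv.inv P.weylGroup)]
  refine Finset.sum_congr rfl fun w _ => ?_
  have h := sum_character_altRep (weylRep P) (resW S k Y) w⁻¹
  rw [inv_inv, character_inv] at h
  rw [mul_right_comm _ (conj _), mul_assoc _ (LinearMap.det _), mul_comm (LinearMap.det _)]
  erw [← h]
  rw [Finset.mul_sum, Finset.mul_sum]
  refine Finset.sum_congr rfl fun n _ => ?_
  rw [Equiv.inv_apply, inv_inv]
  change _ = _ * (_ * (_ * (formRep S k Y n).character w⁻¹))
  ring

variable {k}

lemma hasEulerChar_koszul [P.IsReduced] (hk : IsParameterFunction S k) : ∃ e : ℤ,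
    (e : ℂ) = ellipticPairing (resW S k X) (resW S k Y) ∧
    HasEulerChar ℂ (ModuleCat.of (HeckeAlgebra S k) X) (ModuleCat.of (HeckeAlgebra S k) Y) e := by
  refine ⟨_, ?_, HasEulerChar.of_coresolution (C := fun n => koszulTerm S k Y n)
    koszulAug_injective (exact_koszulAug) (fun n => exact_koszulD hk)
    -- The terms vanish from degree `dim V + 1` on. The sum supplied by
    -- `HasEulerChar.of_coresolution` includes that degree, so one zero summand is split off below.
    (fun n => injective_koszulTerm) (D := Module.finrank ℂ (ℂ ⊗[ℝ] V₀) + 1)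
    (fun n hn => subsingleton_koszulTerm S k Y n hn)⟩
  push_cast
  rw [Finset.sum_range_succ, sum_finrank_hom_koszulTerm]
  have := subsingleton_koszulTerm S k Y (Module.finrank ℂ (ℂ ⊗[ℝ] V₀) + 1) (Nat.lt_succ_self _)
  have : Subsingleton (ModuleCat.of (HeckeAlgebra S k) X ⟶ ModuleCat.of (HeckeAlgebra S k)
      (koszulTerm S k Y (Module.finrank ℂ (ℂ ⊗[ℝ] V₀) + 1))) :=
    ⟨fun f g => ModuleCat.hom_ext (LinearMap.ext fun x =>
      Subsingleton.elim (α := koszulTerm S k Y _) _ _)⟩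
  rw [Module.finrank_zero_of_subsingleton (M := _ ⟶ _), Nat.cast_zero, mul_zero, add_zero]

theorem euler_poincare [P.IsReduced] (hk : IsParameterFunction S k) :
    (∀ i : ℕ, FiniteDimensional ℂ (ExtH S k X Y i)) ∧
      {i : ℕ | Nontrivial (ExtH S k X Y i)}.Finite ∧
      (eulerPoincare S k X Y : ℂ) = ellipticPairing (resW S k X) (resW S k Y) := by
  obtain ⟨e, he, hfin, n, hn, hsum⟩ := hasEulerChar_koszul S X Y hk
  have hlt : ∀ i, ¬ Subsingleton (ExtH S k X Y i) → i < n := fun i h =>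
    not_le.mp fun hi => h (hn i hi)
  refine ⟨hfin, (Set.finite_lt_nat n).subset fun i hi =>
    hlt i (not_subsingleton_iff_nontrivial.mpr hi), ?_⟩
  rw [← he, ← hsum, eulerPoincare, finsum_eq_sum_of_support_subset]
  intro i hi
  refine Finset.mem_coe.mpr (Finset.mem_range.mpr (hlt i fun h => hi ?_))
  change _ * _ = _
  rw [Module.finrank_zero_of_subsingleton, Nat.cast_zero, mul_zero]

end EulerPoincare

end GradedHecke
end

theorem mainTheorem6 {ι V₀ N : Type u} [Finite ι]
    [AddCommGroup V₀] [Module ℝ V₀] [FiniteDimensional ℝ V₀] [AddCommGroup N] [Module ℝ N]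
    (P : RootPairing ι ℝ V₀ N) [P.IsReduced] (S : GradedHecke.SimpleSystem P)
    (k : S.support → ℂ) (hk : GradedHecke.IsParameterFunction S k) :
    (∀ (X Y : Type u)
      [AddCommGroup X] [Module ℂ X] [Module (GradedHecke.HeckeAlgebra S k) X]
      [IsScalarTower ℂ (GradedHecke.HeckeAlgebra S k) X] [FiniteDimensional ℂ X]
      [AddCommGroup Y] [Module ℂ Y] [Module (GradedHecke.HeckeAlgebra S k) Y]
      [IsScalarTower ℂ (GradedHecke.HeckeAlgebra S k) Y] [FiniteDimensional ℂ Y],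
      (∀ i : ℕ, FiniteDimensional ℂ (GradedHecke.ExtH S k X Y i)) ∧
      {i : ℕ | Nontrivial (GradedHecke.ExtH S k X Y i)}.Finite ∧
      (GradedHecke.eulerPoincare S k X Y : ℂ) =
        GradedHecke.ellipticPairing (GradedHecke.resW S k X) (GradedHecke.resW S k Y)) ∧
    (∀ (X X' Y Y' : Type u)
      [AddCommGroup X] [Module ℂ X] [Module (GradedHecke.HeckeAlgebra S k) X]
      [IsScalarTower ℂ (GradedHecke.HeckeAlgebra S k) X] [FiniteDimensional ℂ X]
      [AddCommGroup X'] [Module ℂ X'] [Module (GradedHecke.HeckeAlgebra S k) X']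
      [IsScalarTower ℂ (GradedHecke.HeckeAlgebra S k) X'] [FiniteDimensional ℂ X']
      [AddCommGroup Y] [Module ℂ Y] [Module (GradedHecke.HeckeAlgebra S k) Y]
      [IsScalarTower ℂ (GradedHecke.HeckeAlgebra S k) Y] [FiniteDimensional ℂ Y]
      [AddCommGroup Y'] [Module ℂ Y'] [Module (GradedHecke.HeckeAlgebra S k) Y']
      [IsScalarTower ℂ (GradedHecke.HeckeAlgebra S k) Y'] [FiniteDimensional ℂ Y'],
      Nonempty (Representation.Equiv (GradedHecke.resW S k X) (GradedHecke.resW S k X')) →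
      Nonempty (Representation.Equiv (GradedHecke.resW S k Y) (GradedHecke.resW S k Y')) →
      GradedHecke.eulerPoincare S k X Y = GradedHecke.eulerPoincare S k X' Y') := by
  refine ⟨fun X Y => GradedHecke.euler_poincare S X Y hk, fun X X' Y Y' => ?_⟩
  rintro _ _ _ _ _ _ _ _ _ _ _ _ _ _ _ _ _ _ _ _ ⟨eX⟩ ⟨eY⟩
  have h := (GradedHecke.euler_poincare S X Y hk).2.2
  have h' := (GradedHecke.euler_poincare S X' Y' hk).2.2
  -- The elliptic pairing sees only characters, and these agree for isomorphic representations.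
  rw [GradedHecke.ellipticPairing, Representation.char_iso eX, Representation.char_iso eY] at h
  exact Int.cast_injective (h.trans h'.symm)
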